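/- Throughout, $\otimes$ denotes the minimal (spatial) tensor product of unital C$^*$-algebras. Let $G$ be a compact quantum group, given by a unital C$^*$-algebra $C(G)$ and a coassociative unital $*$-homomorphism $\Delta\colon C(G)\to C(G)\otimes C(G)$ such that $(C(G)\otimes 1)\Delta(C(G))$ and $(1\otimes C(G))\Delta(C(G))$ span dense subspaces of $C(G)\otimes C(G)$. Assume that the Haar state $h$ of $G$ is faithful on $C(G)$. Let $\alpha\colon A\to C(G)\otimes A$ be an action of $G$ on a unital C$^*$-algebra $A$, that is, an injective unital $*$-homomorphism with $(\Delta\otimes\iota)\alpha=(\iota\otimes\alpha)\alpha$ and such that $(C(G)\otimes 1)\alpha(A)$ spans a dense subspace of $C(G)\otimes A$. Let $A^G=\{x\in A:\alpha(x)=1\otimes x\}$ be the algebra of $G$-invariant elements. Then there is a unique $G$-invariant conditional expectation $E\colon A\to A^G$, where $G$-invariance means $(\iota\otimes E)\alpha=1\otimes E(\cdot)$. Moreover, let $P\colon A\to A$ be a unital completely positive (ucp) map such that (i) $P$ commutes with $E$; (ii) $P=tP_1+(1-t)P_2$ for some $0<t<1$ and ucp maps $P_1,P_2\colon A\to A$ such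 that $P_1=(\nu\otimes\iota)\alpha$ for some faithful state $\nu$ on $C(G)$. Then every $P$-harmonic element of $A$, that is, every $x\in A$ with $P(x)=x$, is $G$-invariant. -/

import Mathlib

open scoped TensorProduct ComplexOrder CStarAlgebra

universe u

noncomputable section

namespace CQG

/-- A unital `*`-representation of a unital C⋆-algebra on a complex Hilbert space. -/
structure HilbertRep (A : Type u) [CStarAlgebra A] where
  space : Type u
  [instNormed : NormedAddCommGroup space]
  [instInner : InnerProductSpace ℂ space]
  [instComplete : CompleteSpace space]
  hom : A →⋆ₐ[ℂ] (space →L[ℂ] space)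

attribute [instance] HilbertRep.instNormed HilbertRep.instInner HilbertRep.instComplete

/-- The pullback of a representation along a unital `*`-homomorphism. -/
def HilbertRep.comp {A A' : Type u} [CStarAlgebra A] [CStarAlgebra A']
    (π : HilbertRep A') (f : A →⋆ₐ[ℂ] A') :
    HilbertRep A where
  space := π.space
  hom := π.hom.comp f

section FormalAdjoint

variable {E : Type*} [NormedAddCommGroup E] [InnerProductSpace ℂ E] {S T : E →L[ℂ] E}

theorem norm_le_of_formal_adjoint (h : ∀ v w, inner ℂ (T v) w = inner ℂ v (S w)) :
    ‖S‖ ≤ ‖T‖ := by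
  refine ContinuousLinearMap.opNorm_le_bound _ (norm_nonneg _) fun v => ?_
  have h1 : ‖S v‖ * ‖S v‖ ≤ (‖T‖ * ‖v‖) * ‖S v‖ := by
    have h2 : ‖S v‖ * ‖S v‖ = ‖inner ℂ (S v) (S v)‖ := by
      rw [inner_self_eq_norm_sq_to_K, ← sq]
      simp
    rw [h2, ← h]
    refine (norm_inner_le_norm _ _).trans ?_
    have := T.le_opNorm (S v)
    nlinarith [norm_nonneg v]
  rcases (norm_nonneg (S v)).eq_or_lt with h0 | h0
  · rw [← h0]
    positivity
  · exact le_of_mul_le_mul_right h1 h0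

theorem norm_sq_le_of_formal_adjoint (h : ∀ v w, inner ℂ (T v) w = inner ℂ v (S w)) :
    ‖T‖ * ‖T‖ ≤ ‖S * T‖ := by
  have key : ‖T‖ ≤ Real.sqrt ‖S * T‖ := by
    refine ContinuousLinearMap.opNorm_le_bound _ (Real.sqrt_nonneg _) fun v => ?_
    rw [← Real.sqrt_sq (norm_nonneg v), ← Real.sqrt_mul (norm_nonneg _)]
    refine Real.le_sqrt_of_sq_le ?_
    have h2 : ‖T v‖ ^ 2 = ‖inner ℂ (T v) (T v)‖ := by
      rw [inner_self_eq_norm_sq_to_K]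
      simp
    rw [h2, h]
    refine (norm_inner_le_norm _ _).trans ?_
    have := (S * T).le_opNorm v
    change ‖S (T v)‖ ≤ _ at this
    nlinarith [norm_nonneg v]
  calc _ ≤ Real.sqrt ‖S * T‖ * Real.sqrt ‖S * T‖ := mul_self_le_mul_self (norm_nonneg _) key
    _ = _ := Real.mul_self_sqrt (norm_nonneg _)

end FormalAdjoint

section Norm

variable {A B : Type u} [CStarAlgebra A] [CStarAlgebra B]

/-- The representation `π ⊗ ρ` of the algebraic tensor product `A ⊗ B` by bounded operators on the
(uncompleted) inner product space tensor product of the two Hilbert spaces. -/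
def prodRep (π : HilbertRep A) (ρ : HilbertRep B) :
    A ⊗[ℂ] B →ₐ[ℂ] (π.space ⊗[ℂ] ρ.space →L[ℂ] π.space ⊗[ℂ] ρ.space) :=
  Algebra.TensorProduct.algHomOfLinearMapTensorProduct
    (TensorProduct.lift <| LinearMap.mk₂ ℂ
      (fun a b => TensorProduct.mapL (π.hom a) (ρ.hom b))
      (fun a a' b => by rw [map_add, TensorProduct.mapL_add_left])
      (fun c a b => by rw [map_smul, TensorProduct.mapL_smul_left])
      (fun a b b' => by rw [map_add, TensorProduct.mapL_add_right])
      (fun c a b => by rw [map_smul, TensorProduct.mapL_smul_right]))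
    (fun a a' b b' => by
      ext x : 1
      change TensorProduct.mapL (π.hom (a * a')) (ρ.hom (b * b')) x =
        TensorProduct.mapL (π.hom a) (ρ.hom b) (TensorProduct.mapL (π.hom a') (ρ.hom b') x)
      simp only [map_mul, TensorProduct.mapL_apply]
      exact LinearMap.congr_fun (TensorProduct.map_mul (π.hom a).toLinearMap
        (π.hom a').toLinearMap (ρ.hom b).toLinearMap (ρ.hom b').toLinearMap) x)
    (by
      ext x
      simp)

@[simp]
theorem prodRep_tmul (π : HilbertRep A) (ρ : HilbertRep B) (a : A) (b : B) :
    prodRep π ρ (a ⊗ₜ b) = TensorProduct.mapL (π.hom a) (ρ.hom b) := rfl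

theorem inner_prodRep (π : HilbertRep A) (ρ : HilbertRep B) (x : A ⊗[ℂ] B)
    (v w : π.space ⊗[ℂ] ρ.space) :
    inner ℂ (prodRep π ρ x v) w = inner ℂ v (prodRep π ρ (star x) w) := by
  induction x with
  | zero => simp
  | add x y hx hy => simp [inner_add_left, inner_add_right, hx, hy]
  | tmul a b =>
    induction v with
    | zero => simp
    | add v v' hv hv' => simp only [map_add, inner_add_left, hv, hv']
    | tmul v v' =>
      induction w with
      | zero => simp
      | add w w' hw hw' => simp only [map_add, inner_add_right, hw, hw']
      | tmul w w' =>
        simp [map_star, ContinuousLinearMap.star_eq_adjoint,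
          ContinuousLinearMap.adjoint_inner_right]

theorem norm_prodRep_star_le (π : HilbertRep A) (ρ : HilbertRep B) (x : A ⊗[ℂ] B) :
    ‖prodRep π ρ (star x)‖ ≤ ‖prodRep π ρ x‖ :=
  norm_le_of_formal_adjoint (inner_prodRep π ρ x)

theorem norm_prodRep_sq_le (π : HilbertRep A) (ρ : HilbertRep B) (x : A ⊗[ℂ] B) :
    ‖prodRep π ρ x‖ * ‖prodRep π ρ x‖ ≤ ‖prodRep π ρ (star x * x)‖ := by
  have h := norm_sq_le_of_formal_adjoint (inner_prodRep π ρ x)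
  rw [map_mul]
  exact h

/-- The minimal (spatial) C⋆-seminorm on the algebraic tensor product `A ⊗ B`:
`‖x‖_min = sup ‖(π ⊗ ρ)(x)‖`, over all representations `π` of `A` and `ρ` of `B`. -/
def minNorm (x : A ⊗[ℂ] B) : ℝ :=
  ⨆ p : HilbertRep A × HilbertRep B, ‖prodRep p.1 p.2 x‖

theorem bddAbove_norm_prodRep (x : A ⊗[ℂ] B) :
    BddAbove (Set.range fun p : HilbertRep A × HilbertRep B => ‖prodRep p.1 p.2 x‖) := by
  suffices h : ∃ M : ℝ, ∀ p : HilbertRep A × HilbertRep B, ‖prodRep p.1 p.2 x‖ ≤ M by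
    obtain ⟨M, hM⟩ := h
    exact ⟨M, by rintro _ ⟨p, rfl⟩; exact hM p⟩
  induction x with
  | zero => exact ⟨0, fun p => by rw [map_zero]; exact ContinuousLinearMap.opNorm_zero.le⟩
  | add x y hx hy =>
    obtain ⟨M, hM⟩ := hx
    obtain ⟨N, hN⟩ := hy
    refine ⟨M + N, fun p => ?_⟩
    rw [map_add]
    exact (ContinuousLinearMap.opNorm_add_le _ _).trans (add_le_add (hM p) (hN p))
  | tmul a b =>
    refine ⟨‖a‖ * ‖b‖, fun p => ?_⟩
    rw [prodRep_tmul]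
    exact (TensorProduct.norm_mapL_le _ _).trans
      (mul_le_mul (NonUnitalStarAlgHom.norm_apply_le _ a) (NonUnitalStarAlgHom.norm_apply_le _ b)
        (norm_nonneg _) (norm_nonneg _))

theorem norm_prodRep_le (π : HilbertRep A) (ρ : HilbertRep B) (x : A ⊗[ℂ] B) :
    ‖prodRep π ρ x‖ ≤ minNorm x :=
  le_ciSup (bddAbove_norm_prodRep x) (π, ρ)

instance : Inhabited (HilbertRep A) where
  default :=
    { space := PUnit
      hom :=
        { toFun := fun _ => 0
          map_one' := Subsingleton.elim _ _
          map_mul' := fun _ _ => Subsingleton.elim _ _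
          map_zero' := rfl
          map_add' := fun _ _ => Subsingleton.elim _ _
          commutes' := fun _ => Subsingleton.elim _ _
          map_star' := fun _ => Subsingleton.elim _ _ } }

theorem minNorm_le {x : A ⊗[ℂ] B} {M : ℝ}
    (h : ∀ (π : HilbertRep A) (ρ : HilbertRep B), ‖prodRep π ρ x‖ ≤ M) : minNorm x ≤ M :=
  ciSup_le fun p => h p.1 p.2

theorem minNorm_nonneg (x : A ⊗[ℂ] B) : 0 ≤ minNorm x :=
  Real.iSup_nonneg fun _ => ContinuousLinearMap.opNorm_nonneg _

theorem minNorm_zero : minNorm (0 : A ⊗[ℂ] B) = 0 :=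
  le_antisymm (minNorm_le fun π ρ => by rw [map_zero]; exact ContinuousLinearMap.opNorm_zero.le) (minNorm_nonneg _)

theorem minNorm_add_le (x y : A ⊗[ℂ] B) : minNorm (x + y) ≤ minNorm x + minNorm y :=
  minNorm_le fun π ρ => by
    rw [map_add]
    exact (ContinuousLinearMap.opNorm_add_le _ _).trans
      (add_le_add (norm_prodRep_le π ρ x) (norm_prodRep_le π ρ y))

theorem minNorm_smul_le (c : ℂ) (x : A ⊗[ℂ] B) : minNorm (c • x) ≤ ‖c‖ * minNorm x :=
  minNorm_le fun π ρ => by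
    rw [map_smul]
    exact (ContinuousLinearMap.opNorm_smul_le _ _).trans
      (mul_le_mul_of_nonneg_left (norm_prodRep_le π ρ x) (norm_nonneg c))

theorem minNorm_neg (x : A ⊗[ℂ] B) : minNorm (-x) = minNorm x := by
  have h (y : A ⊗[ℂ] B) : minNorm (-y) ≤ minNorm y := by
    have := minNorm_smul_le (-1) y
    simpa using this
  exact le_antisymm (h x) (by simpa using h (-x))

theorem minNorm_mul_le (x y : A ⊗[ℂ] B) : minNorm (x * y) ≤ minNorm x * minNorm y :=
  minNorm_le fun π ρ => by
    rw [map_mul]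
    exact (ContinuousLinearMap.opNorm_comp_le _ _).trans
      (mul_le_mul (norm_prodRep_le π ρ x) (norm_prodRep_le π ρ y)
        (ContinuousLinearMap.opNorm_nonneg _) (minNorm_nonneg _))

theorem minNorm_star_le (x : A ⊗[ℂ] B) : minNorm (star x) ≤ minNorm x :=
  minNorm_le fun π ρ => (norm_prodRep_star_le π ρ x).trans (norm_prodRep_le π ρ x)

theorem minNorm_sq_le (x : A ⊗[ℂ] B) : minNorm x * minNorm x ≤ minNorm (star x * x) := by
  have key : minNorm x ≤ Real.sqrt (minNorm (star x * x)) :=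
    minNorm_le fun π ρ => Real.le_sqrt_of_sq_le <| by
      rw [sq]
      exact (norm_prodRep_sq_le π ρ x).trans (norm_prodRep_le π ρ _)
  calc _ ≤ Real.sqrt (minNorm (star x * x)) * Real.sqrt (minNorm (star x * x)) :=
        mul_self_le_mul_self (minNorm_nonneg _) key
    _ = _ := Real.mul_self_sqrt (minNorm_nonneg _)

end Norm

section Completion

/-- The algebraic tensor product `A ⊗ B`, as a type carrying the minimal C⋆-seminorm. -/
def AlgMinTensor (A B : Type u) [CStarAlgebra A] [CStarAlgebra B] : Type u := A ⊗[ℂ] B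

variable {A B : Type u} [CStarAlgebra A] [CStarAlgebra B]

instance : Ring (AlgMinTensor A B) := inferInstanceAs (Ring (A ⊗[ℂ] B))
instance : Algebra ℂ (AlgMinTensor A B) := inferInstanceAs (Algebra ℂ (A ⊗[ℂ] B))
instance : StarRing (AlgMinTensor A B) := inferInstanceAs (StarRing (A ⊗[ℂ] B))
instance : StarModule ℂ (AlgMinTensor A B) := inferInstanceAs (StarModule ℂ (A ⊗[ℂ] B))

instance : SeminormedAddCommGroup (AlgMinTensor A B) :=
  AddGroupSeminorm.toSeminormedAddCommGroup
    { toFun := fun x : AlgMinTensor A B => minNorm (A := A) (B := B) x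
      map_zero' := minNorm_zero
      add_le' := minNorm_add_le
      neg' := minNorm_neg }

theorem AlgMinTensor.norm_def (x : AlgMinTensor A B) : ‖x‖ = minNorm (A := A) (B := B) x := rfl

instance : SeminormedRing (AlgMinTensor A B) where
  __ : SeminormedAddCommGroup (AlgMinTensor A B) := inferInstance
  __ : Ring (AlgMinTensor A B) := inferInstance
  norm_mul_le x y := minNorm_mul_le (A := A) (B := B) x y

instance : NormedAlgebra ℂ (AlgMinTensor A B) where
  norm_smul_le c x := minNorm_smul_le (A := A) (B := B) c x

theorem AlgMinTensor.norm_star (x : AlgMinTensor A B) : ‖star x‖ = ‖x‖ :=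
  le_antisymm (minNorm_star_le (A := A) (B := B) x)
    ((congrArg norm (star_star x)).symm.le.trans
      (minNorm_star_le (A := A) (B := B) (star (x : A ⊗[ℂ] B))))

instance : NormedStarGroup (AlgMinTensor A B) where
  norm_star_le x := (AlgMinTensor.norm_star x).le

namespace AlgMinTensor

open UniformSpace

instance : NormedAlgebra ℂ (Completion (AlgMinTensor A B)) where
  norm_smul_le := norm_smul_le

instance : Star (Completion (AlgMinTensor A B)) where
  star := Completion.map (star : AlgMinTensor A B → AlgMinTensor A B)

instance : ContinuousStar (Completion (AlgMinTensor A B)) where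
  continuous_star := Completion.continuous_map

theorem star_coe (x : AlgMinTensor A B) :
    star (x : Completion (AlgMinTensor A B)) = ((star x : AlgMinTensor A B) : Completion (AlgMinTensor A B)) :=
  Completion.map_coe (starNormedAddGroupHom (E := AlgMinTensor A B)).uniformContinuous x

instance : StarRing (Completion (AlgMinTensor A B)) where
  star_involutive x := by
    induction x using Completion.induction_on with
    | hp => exact isClosed_eq (by fun_prop) (by fun_prop)
    | ih y => rw [star_coe, star_coe, star_star]
  star_mul x y := by
    induction x, y using Completion.induction_on₂ with
    | hp => exact isClosed_eq (by fun_prop) (by fun_prop)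
    | ih a b => rw [← Completion.coe_mul, star_coe, star_mul, Completion.coe_mul, star_coe, star_coe]
  star_add x y := by
    induction x, y using Completion.induction_on₂ with
    | hp => exact isClosed_eq (by fun_prop) (by fun_prop)
    | ih a b => rw [← Completion.coe_add, star_coe, star_add, Completion.coe_add, star_coe, star_coe]

instance : CStarRing (Completion (AlgMinTensor A B)) where
  norm_mul_self_le x := by
    induction x using Completion.induction_on with
    | hp => exact isClosed_le (by fun_prop) (by fun_prop)
    | ih y =>
      rw [star_coe, ← Completion.coe_mul, Completion.norm_coe, Completion.norm_coe]
      exact minNorm_sq_le (A := A) (B := B) y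

instance : StarModule ℂ (Completion (AlgMinTensor A B)) where
  star_smul c x := by
    induction x using Completion.induction_on with
    | hp =>
      exact isClosed_eq (continuous_star.comp (continuous_const_smul c))
        (continuous_star.const_smul (star c))
    | ih y => rw [← Completion.coe_smul, star_coe, star_smul, Completion.coe_smul, star_coe]

instance : CStarAlgebra (Completion (AlgMinTensor A B)) where

end AlgMinTensor

/-- The minimal (spatial) tensor product `A ⊗ B` of two unital C⋆-algebras: the completion of the
algebraic tensor product in the minimal C⋆-norm. -/
def MinTensor (A B : Type u) [CStarAlgebra A] [CStarAlgebra B] : Type u :=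
  UniformSpace.Completion (AlgMinTensor A B)

namespace MinTensor

instance : CStarAlgebra (MinTensor A B) :=
  inferInstanceAs (CStarAlgebra (UniformSpace.Completion (AlgMinTensor A B)))

/-- The canonical map from the algebraic to the minimal tensor product. -/
def ofAlg : A ⊗[ℂ] B →⋆ₐ[ℂ] MinTensor A B where
  toFun := fun x : AlgMinTensor A B => (x : UniformSpace.Completion (AlgMinTensor A B))
  map_one' := rfl
  map_mul' x y := UniformSpace.Completion.coe_mul (α := AlgMinTensor A B) x y
  map_zero' := rfl
  map_add' x y := UniformSpace.Completion.coe_add (α := AlgMinTensor A B) x y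
  commutes' _ := rfl
  map_star' x := (AlgMinTensor.star_coe (A := A) (B := B) x).symm

/-- The elementary tensor `a ⊗ b` in the minimal tensor product. -/
def tmul (a : A) (b : B) : MinTensor A B := ofAlg (a ⊗ₜ b)

theorem norm_ofAlg (x : A ⊗[ℂ] B) : ‖ofAlg x‖ = minNorm x :=
  UniformSpace.Completion.norm_coe (E := AlgMinTensor A B) x

theorem denseRange_ofAlg : DenseRange (ofAlg : A ⊗[ℂ] B →⋆ₐ[ℂ] MinTensor A B) :=
  UniformSpace.Completion.denseRange_coe (α := AlgMinTensor A B)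

theorem exists_bound_of_minNorm {D : Type u} [NormedAddCommGroup D] [NormedSpace ℂ D]
    {f : A ⊗[ℂ] B →ₗ[ℂ] D} (hf : ∀ x, ‖f x‖ ≤ minNorm x) :
    ∃ c, ∀ x, ‖f x‖ ≤ c * ‖(ofAlg : A ⊗[ℂ] B →⋆ₐ[ℂ] MinTensor A B).toLinearMap x‖ :=
  ⟨1, fun x => by
    rw [one_mul]
    exact (hf x).trans_eq (norm_ofAlg x).symm⟩

/-- A linear map on the algebraic tensor product that is contractive for the minimal norm extends
(uniquely) to a continuous linear map on the minimal tensor product. -/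
def extendL {D : Type u} [NormedAddCommGroup D] [NormedSpace ℂ D] [CompleteSpace D]
    (f : A ⊗[ℂ] B →ₗ[ℂ] D) : MinTensor A B →L[ℂ] D :=
  f.extendOfNorm (ofAlg : A ⊗[ℂ] B →⋆ₐ[ℂ] MinTensor A B).toLinearMap

theorem extendL_ofAlg {D : Type u} [NormedAddCommGroup D] [NormedSpace ℂ D] [CompleteSpace D]
    {f : A ⊗[ℂ] B →ₗ[ℂ] D} (hf : ∀ x, ‖f x‖ ≤ minNorm x) (x : A ⊗[ℂ] B) :
    extendL f (ofAlg x) = f x :=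
  LinearMap.extendOfNorm_eq (f := f)
    (e := (ofAlg : A ⊗[ℂ] B →⋆ₐ[ℂ] MinTensor A B).toLinearMap) denseRange_ofAlg
    (exists_bound_of_minNorm hf) x

/-- A `*`-homomorphism on the algebraic tensor product that is contractive for the minimal norm
extends to the minimal tensor product. -/
def lift {D : Type u} [CStarAlgebra D] (f : A ⊗[ℂ] B →⋆ₐ[ℂ] D) (hf : ∀ x, ‖f x‖ ≤ minNorm x) :
    MinTensor A B →⋆ₐ[ℂ] D :=
  have key (x : A ⊗[ℂ] B) : extendL f.toLinearMap (ofAlg x) = f x := extendL_ofAlg hf x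
  { toFun := extendL f.toLinearMap
    map_one' := by rw [← map_one ofAlg, key, map_one]
    map_mul' := fun x y => by
      refine denseRange_ofAlg.induction_on₂
        (p := fun x y => extendL f.toLinearMap (x * y) =
          extendL f.toLinearMap x * extendL f.toLinearMap y)
        (isClosed_eq (by fun_prop) (by fun_prop)) (fun a b => ?_) x y
      rw [← map_mul, key, key, key, map_mul]
    map_zero' := map_zero _
    map_add' := map_add _
    commutes' := fun c => by
      rw [Algebra.algebraMap_eq_smul_one, map_smul, ← map_one ofAlg, key, map_one,
        Algebra.algebraMap_eq_smul_one]
    map_star' := fun x => by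
      refine denseRange_ofAlg.induction_on
        (p := fun x => extendL f.toLinearMap (star x) = star (extendL f.toLinearMap x)) x
        (isClosed_eq (by fun_prop) (by fun_prop)) (fun a => ?_)
      rw [← map_star, key, key, map_star] }

theorem lift_ofAlg {D : Type u} [CStarAlgebra D] (f : A ⊗[ℂ] B →⋆ₐ[ℂ] D)
    (hf : ∀ x, ‖f x‖ ≤ minNorm x) (x : A ⊗[ℂ] B) : lift f hf (ofAlg x) = f x :=
  extendL_ofAlg (f := f.toLinearMap) hf x

variable {A' B' : Type u} [CStarAlgebra A'] [CStarAlgebra B']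

/-- The `*`-homomorphism `f ⊗ g` between algebraic tensor products. -/
def algMap (f : A →⋆ₐ[ℂ] A') (g : B →⋆ₐ[ℂ] B') : A ⊗[ℂ] B →⋆ₐ[ℂ] A' ⊗[ℂ] B' where
  __ := Algebra.TensorProduct.map f.toAlgHom g.toAlgHom
  map_star' x := by
    change Algebra.TensorProduct.map f.toAlgHom g.toAlgHom (star x) =
      star (Algebra.TensorProduct.map f.toAlgHom g.toAlgHom x)
    induction x with
    | zero => simp
    | add x y hx hy => simp only [star_add, map_add, hx, hy]
    | tmul a b => simp [map_star]

theorem algMap_tmul (f : A →⋆ₐ[ℂ] A') (g : B →⋆ₐ[ℂ] B') (a : A) (b : B) :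
    algMap f g (a ⊗ₜ b) = f a ⊗ₜ g b := rfl

theorem minNorm_algMap_le (f : A →⋆ₐ[ℂ] A') (g : B →⋆ₐ[ℂ] B') (x : A ⊗[ℂ] B) :
    minNorm (algMap f g x) ≤ minNorm x := by
  refine minNorm_le fun π ρ => ?_
  let P : A ⊗[ℂ] B →ₐ[ℂ] (π.space ⊗[ℂ] ρ.space →L[ℂ] π.space ⊗[ℂ] ρ.space) :=
    prodRep (π.comp f) (ρ.comp g)
  have h : (prodRep π ρ).comp (algMap f g).toAlgHom = P :=
    Algebra.TensorProduct.ext' fun a b => rfl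
  have h' : prodRep π ρ (algMap f g x) = P x := DFunLike.congr_fun h x
  rw [h']
  exact norm_prodRep_le (π.comp f) (ρ.comp g) x

theorem norm_ofAlg_algMap_le (f : A →⋆ₐ[ℂ] A') (g : B →⋆ₐ[ℂ] B') (x : A ⊗[ℂ] B) :
    ‖(ofAlg (A := A') (B := B')).comp (algMap f g) x‖ ≤ minNorm x := by
  have h := norm_ofAlg (algMap f g x)
  exact h.trans_le (minNorm_algMap_le f g x)

/-- The `*`-homomorphism `f ⊗ g` between minimal tensor products. -/
def map (f : A →⋆ₐ[ℂ] A') (g : B →⋆ₐ[ℂ] B') : MinTensor A B →⋆ₐ[ℂ] MinTensor A' B' :=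
  lift ((ofAlg (A := A') (B := B')).comp (algMap f g)) (norm_ofAlg_algMap_le f g)

theorem map_tmul (f : A →⋆ₐ[ℂ] A') (g : B →⋆ₐ[ℂ] B') (a : A) (b : B) :
    map f g (tmul a b) = tmul (f a) (g b) := by
  rw [map, tmul, lift_ofAlg]
  rfl

end MinTensor
end Completion

section States

/-- A state on a unital C⋆-algebra: a positive linear functional with value `1` at the unit. -/
structure State (A : Type u) [CStarAlgebra A] where
  toLinearMap : A →ₗ[ℂ] ℂ
  map_one : toLinearMap 1 = 1
  nonneg : ∀ a, 0 ≤ toLinearMap (star a * a)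

instance (A : Type u) [CStarAlgebra A] : CoeFun (State A) (fun _ => A → ℂ) :=
  ⟨fun φ => φ.toLinearMap⟩

variable {A : Type u} [CStarAlgebra A]

/-- A state is faithful if it does not vanish on nonzero positive elements. -/
def State.Faithful (φ : State A) : Prop :=
  ∀ a, φ (star a * a) = 0 → a = 0

theorem State.exists_rep (φ : State A) :
    ∃ (π : HilbertRep A) (ξ : π.space), ‖ξ‖ = 1 ∧ ∀ a, inner ℂ ξ (π.hom a ξ) = φ a := by
  let _ := CStarAlgebra.spectralOrder A
  let _ := CStarAlgebra.spectralOrderedRing A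
  let f : A →ₚ[ℂ] ℂ := PositiveLinearMap.mk₀ φ.toLinearMap fun x hx => by
    obtain ⟨y, rfl⟩ := CStarAlgebra.nonneg_iff_eq_star_mul_self.mp hx
    exact φ.nonneg y
  let ξ : f.GNS := ((f.toPreGNS 1 : f.PreGNS) : f.GNS)
  have hin (a : A) : inner ℂ ξ (f.gnsStarAlgHom a ξ) = φ a := by
    change inner ℂ ξ (f.gnsNonUnitalStarAlgHom a ξ) = φ a
    rw [PositiveLinearMap.gnsNonUnitalStarAlgHom_apply_coe, UniformSpace.Completion.inner_coe,
      PositiveLinearMap.preGNS_inner_def]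
    simp
    rfl
  refine ⟨⟨f.GNS, f.gnsStarAlgHom⟩, ξ, ?_, hin⟩
  have h1 := hin 1
  rw [_root_.map_one, φ.map_one] at h1
  change inner ℂ ξ ξ = 1 at h1
  rw [inner_self_eq_norm_sq_to_K] at h1
  have h1' : (‖ξ‖ : ℂ) ^ 2 = 1 := h1
  have h2 : ‖ξ‖ ^ 2 = 1 := by exact_mod_cast h1'
  nlinarith [norm_nonneg ξ]

theorem exists_state_norm [Nontrivial A] (b : A) :
    ∃ φ : State A, φ (star b * b) = (‖b‖ ^ 2 : ℝ) := by
  let _ := CStarAlgebra.spectralOrder A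
  let _ := CStarAlgebra.spectralOrderedRing A
  set c := star b * b with hc
  have hc0 : 0 ≤ c := star_mul_self_nonneg b
  have hcn : ‖c‖ = ‖b‖ ^ 2 := by rw [hc, CStarRing.norm_star_mul_self, sq]
  have hnorm : 1 + ‖c‖ ≤ ‖1 + c‖ := by
    have h1 := CStarAlgebra.norm_mem_spectrum_of_nonneg hc0
    have h2 : 1 + ‖c‖ ∈ spectrum ℝ (algebraMap ℝ A 1 + c) :=
      by
        rw [add_comm 1 ‖c‖]
        exact spectrum.add_mem_add_iff.mpr h1
    have h3 := spectrum.norm_le_norm_of_mem h2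
    rw [_root_.map_one] at h3
    exact (le_abs_self _).trans h3
  obtain ⟨g, hg1, hg⟩ := exists_dual_vector'' ℂ (1 + c)
  have hg_le (x : A) : ‖g x‖ ≤ ‖x‖ := by simpa using g.le_of_opNorm_le hg1 x
  have hone : ‖g 1‖ ≤ 1 := by simpa using hg_le 1
  have hgc : ‖g c‖ ≤ ‖c‖ := hg_le c
  have hsum : (g 1).re + (g c).re = ‖1 + c‖ := by
    have := congrArg Complex.re hg
    simpa using this
  have hr1 : (g 1).re = 1 := by
    have := Complex.re_le_norm (g 1)
    have := Complex.re_le_norm (g c)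
    linarith
  have hrc : (g c).re = ‖c‖ := by
    have := Complex.re_le_norm (g 1)
    have := Complex.re_le_norm (g c)
    linarith
  have hre {z : ℂ} {r : ℝ} (h1 : z.re = r) (h2 : ‖z‖ ≤ r) : z = r := by
    have h3 := Complex.sq_norm z
    rw [Complex.normSq_apply] at h3
    have h4 : z.im = 0 := by nlinarith [norm_nonneg z]
    exact Complex.ext (by simpa using h1) (by simpa using h4)
  have h1 : g 1 = 1 := by simpa using hre hr1 hone
  have hpos (a : A) (ha : 0 ≤ a) : 0 ≤ g a := by
    have hsa : IsSelfAdjoint a := IsSelfAdjoint.of_nonneg ha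
    have hbound (t : ℝ) : ((g a).im + t) ^ 2 ≤ ‖a‖ ^ 2 + t ^ 2 := by
      set d : A := a + (t * Complex.I : ℂ) • (1 : A) with hd
      have hgd : (g d).im = (g a).im + t := by simp [hd, h1]
      have hdd : star d * d = a * a + ((t : ℂ) ^ 2) • (1 : A) := by
        have h6 : star d = a - (t * Complex.I : ℂ) • (1 : A) := by
          rw [hd, star_add, hsa.star_eq, star_smul, star_one]
          simp [sub_eq_add_neg]
        rw [h6, hd]
        simp only [sub_mul, mul_add, smul_mul_assoc, one_mul, mul_smul_comm, mul_one,
          smul_sub]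
        rw [smul_smul]
        have h7 : (t * Complex.I * (t * Complex.I) : ℂ) = -(t : ℂ) ^ 2 := by
          linear_combination (t : ℂ) ^ 2 * Complex.I_sq
        rw [h7, neg_smul]
        abel
      have h8 : ‖d‖ ^ 2 ≤ ‖a‖ ^ 2 + t ^ 2 := by
        rw [sq, ← CStarRing.norm_star_mul_self, hdd]
        refine (norm_add_le _ _).trans (add_le_add ?_ ?_)
        · rw [sq]; exact norm_mul_le _ _
        · rw [norm_smul, norm_one, mul_one, norm_pow, Complex.norm_real, Real.norm_eq_abs, sq_abs]
      have h9 : |(g d).im| ≤ ‖d‖ := (Complex.abs_im_le_norm _).trans (hg_le d)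
      rw [← hgd, ← sq_abs]
      exact (pow_le_pow_left₀ (abs_nonneg _) h9 2).trans h8
    have him : (g a).im = 0 := by
      by_contra hne
      have h6 := hbound (‖a‖ ^ 2 / (g a).im)
      have h7 : (g a).im * (‖a‖ ^ 2 / (g a).im) = ‖a‖ ^ 2 := by field_simp
      have h8 : 0 < (g a).im ^ 2 := by positivity
      nlinarith [sq_nonneg ‖a‖]
    have h5 : ‖g (algebraMap ℝ A ‖a‖ - a)‖ ≤ ‖a‖ := by
      refine (hg_le _).trans ?_
      rw [CStarAlgebra.norm_le_iff_le_algebraMap _ (norm_nonneg a)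
        (sub_nonneg.mpr hsa.le_algebraMap_norm_self)]
      exact sub_le_self _ ha
    have h6 : (g (algebraMap ℝ A ‖a‖ - a)).re = ‖a‖ - (g a).re := by
      rw [Algebra.algebraMap_eq_smul_one, ← Complex.coe_smul, map_sub, map_smul, h1]
      simp
    have h7 := Complex.re_le_norm (g (algebraMap ℝ A ‖a‖ - a))
    rw [Complex.nonneg_iff]
    exact ⟨by linarith, him.symm⟩
  exact ⟨⟨g.toLinearMap, h1, fun a => hpos _ (star_mul_self_nonneg a)⟩, by
    have := hre hrc hgc
    rw [hcn] at this
    exact this⟩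

theorem exists_rep_norm (b : A) : ∃ ρ : HilbertRep A, ‖b‖ ≤ ‖ρ.hom b‖ := by
  rcases subsingleton_or_nontrivial A with h | h
  · exact ⟨default, by rw [Subsingleton.elim b 0, norm_zero]; exact norm_nonneg _⟩
  obtain ⟨φ, hφ⟩ := exists_state_norm b
  obtain ⟨ρ, ξ, hξ, h⟩ := φ.exists_rep
  refine ⟨ρ, ?_⟩
  have h1 : (‖ρ.hom b ξ‖ : ℂ) ^ 2 = (‖b‖ ^ 2 : ℝ) := by
    rw [← hφ, ← h, map_mul, map_star, ContinuousLinearMap.star_eq_adjoint]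
    change _ = inner ℂ ξ ((ρ.hom b).adjoint (ρ.hom b ξ))
    rw [ContinuousLinearMap.adjoint_inner_right, inner_self_eq_norm_sq_to_K]
    rfl
  have h2 : ‖ρ.hom b ξ‖ ^ 2 = ‖b‖ ^ 2 := by exact_mod_cast h1
  have h3 : ‖ρ.hom b ξ‖ = ‖b‖ := by
    rwa [sq_eq_sq₀ (norm_nonneg _) (norm_nonneg _)] at h2
  calc ‖b‖ = ‖ρ.hom b ξ‖ := h3.symm
    _ ≤ ‖ρ.hom b‖ * ‖ξ‖ := ContinuousLinearMap.le_opNorm _ _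
    _ = ‖ρ.hom b‖ := by rw [hξ, mul_one]

end States
section Slice

variable {A B : Type u} [CStarAlgebra A] [CStarAlgebra B]

/-- The slice map `φ ⊗ ι : A ⊗ B → B` of a state `φ` on the algebraic tensor product. -/
def algSlice (φ : State A) : A ⊗[ℂ] B →ₗ[ℂ] B :=
  TensorProduct.lift (φ.toLinearMap.smulRight (LinearMap.id : B →ₗ[ℂ] B))

theorem algSlice_tmul (φ : State A) (a : A) (b : B) : algSlice φ (a ⊗ₜ b) = φ a • b := rfl

theorem inner_prodRep_tmul {φ : State A} {π : HilbertRep A} {ξ : π.space}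
    (h : ∀ a, inner ℂ ξ (π.hom a ξ) = φ a) (ρ : HilbertRep B) (x : A ⊗[ℂ] B) (k k' : ρ.space) :
    inner ℂ (ξ ⊗ₜ[ℂ] k') (prodRep π ρ x (ξ ⊗ₜ[ℂ] k)) = inner ℂ k' (ρ.hom (algSlice φ x) k) := by
  induction x with
  | zero => simp
  | add x y hx hy => simp only [map_add, _root_.add_apply, inner_add_right, hx, hy]
  | tmul a b =>
    rw [prodRep_tmul, TensorProduct.mapL_tmul, TensorProduct.inner_tmul, h, algSlice_tmul,
      map_smul, _root_.smul_apply, inner_smul_right]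

theorem norm_algSlice_le (φ : State A) (x : A ⊗[ℂ] B) : ‖algSlice φ x‖ ≤ minNorm x := by
  obtain ⟨ρ, hρ⟩ := exists_rep_norm (algSlice φ x)
  obtain ⟨π, ξ, hξ, h⟩ := φ.exists_rep
  have key := inner_prodRep_tmul h ρ x
  refine hρ.trans (le_trans ?_ (norm_prodRep_le π ρ x))
  refine ContinuousLinearMap.opNorm_le_bound _ (ContinuousLinearMap.opNorm_nonneg _) fun k => ?_
  set w := ρ.hom (algSlice φ x) k with hw
  have hk (v : ρ.space) : ‖ξ ⊗ₜ[ℂ] v‖ = ‖v‖ := by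
    rw [TensorProduct.norm_tmul, hξ, one_mul]
  have h1 : ‖w‖ * ‖w‖ = ‖inner ℂ w w‖ := by
    rw [inner_self_eq_norm_sq_to_K, ← sq]
    simp
  have h2 : ‖w‖ * ‖w‖ ≤ ‖w‖ * ‖prodRep π ρ x (ξ ⊗ₜ[ℂ] k)‖ := by
    rw [h1, hw, ← key, ← hw, ← hk w]
    exact norm_inner_le_norm (𝕜 := ℂ) (ξ ⊗ₜ[ℂ] w) _
  have h3 : ‖prodRep π ρ x (ξ ⊗ₜ[ℂ] k)‖ ≤ ‖prodRep π ρ x‖ * ‖k‖ := by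
    rw [← hk k]
    exact ContinuousLinearMap.le_opNorm _ _
  rcases (norm_nonneg w).eq_or_lt with h0 | h0
  · rw [← h0]
    exact mul_nonneg (ContinuousLinearMap.opNorm_nonneg _) (norm_nonneg _)
  · exact (le_of_mul_le_mul_left h2 h0).trans h3

/-- The slice map `φ ⊗ ι : A ⊗ B → B` of a state `φ` on the minimal tensor product: the unique
continuous linear map sending `a ⊗ b` to `φ(a) b`. -/
def slice (φ : State A) : MinTensor A B →L[ℂ] B :=
  MinTensor.extendL (algSlice φ)

theorem slice_ofAlg (φ : State A) (x : A ⊗[ℂ] B) : slice φ (MinTensor.ofAlg x) = algSlice φ x :=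
  MinTensor.extendL_ofAlg (norm_algSlice_le φ) x

theorem slice_tmul (φ : State A) (a : A) (b : B) : slice φ (MinTensor.tmul a b) = φ a • b :=
  slice_ofAlg φ _

end Slice

section QuantumGroup

open MinTensor

/-- `AssocRel u v` says that `u ∈ (A ⊗ B) ⊗ D` and `v ∈ A ⊗ (B ⊗ D)` correspond to each other under
the canonical identification of these two minimal tensor products, that is, under the closure
of the correspondence `∑ (aᵢ ⊗ bᵢ) ⊗ dᵢ ↔ ∑ aᵢ ⊗ (bᵢ ⊗ dᵢ)`. -/
def AssocRel {A B D : Type u} [CStarAlgebra A] [CStarAlgebra B] [CStarAlgebra D]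
    (u : MinTensor (MinTensor A B) D) (v : MinTensor A (MinTensor B D)) : Prop :=
  (u, v) ∈ closure (Submodule.span ℂ
    {p : MinTensor (MinTensor A B) D × MinTensor A (MinTensor B D) |
      ∃ a b d, p = (tmul (tmul a b) d, tmul a (tmul b d))} :
    Set (MinTensor (MinTensor A B) D × MinTensor A (MinTensor B D)))

/-- A compact quantum group `G` with algebra of continuous functions `C = C(G)`: a unital
C⋆-algebra with a unital `*`-homomorphism `Δ : C → C ⊗ C` that is coassociative,
`(Δ ⊗ ι) Δ = (ι ⊗ Δ) Δ`, and such that `(C ⊗ 1) Δ(C)` and `(1 ⊗ C) Δ(C)` span dense subspaces of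
`C ⊗ C`. -/
structure CompactQuantumGroup (C : Type u) [CStarAlgebra C] where
  comul : C →⋆ₐ[ℂ] MinTensor C C
  coassoc : ∀ x, AssocRel (map comul (StarAlgHom.id ℂ C) (comul x))
    (map (StarAlgHom.id ℂ C) comul (comul x))
  dense_left : Dense (Submodule.span ℂ {y | ∃ a b, y = tmul a 1 * comul b} : Set (MinTensor C C))
  dense_right : Dense (Submodule.span ℂ {y | ∃ a b, y = tmul 1 a * comul b} : Set (MinTensor C C))

namespace CompactQuantumGroup

variable {C : Type u} [CStarAlgebra C]

/-- The convolution `φ * ψ = (φ ⊗ ψ) Δ` of two states, as a function on `C(G)`. -/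
def conv (G : CompactQuantumGroup C) (φ ψ : State C) (x : C) : ℂ :=
  ψ (slice φ (G.comul x))

/-- `h` is the Haar state: `φ * h = h = h * φ` for every state `φ`. -/
def IsHaarState (G : CompactQuantumGroup C) (h : State C) : Prop :=
  ∀ (φ : State C) (x : C), G.conv φ h x = h x ∧ G.conv h φ x = h x

/-- A (continuous, left) action of `G` on a unital C⋆-algebra `A`: an injective unital
`*`-homomorphism `α : A → C(G) ⊗ A` such that `(Δ ⊗ ι) α = (ι ⊗ α) α` and `(C(G) ⊗ 1) α(A)` spans a
dense subspace of `C(G) ⊗ A`. -/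
structure Action (G : CompactQuantumGroup C) (A : Type u) [CStarAlgebra A] where
  coact : A →⋆ₐ[ℂ] MinTensor C A
  injective : Function.Injective coact
  coassoc : ∀ x, AssocRel (map G.comul (StarAlgHom.id ℂ A) (coact x))
    (map (StarAlgHom.id ℂ C) coact (coact x))
  dense : Dense (Submodule.span ℂ {y | ∃ c a, y = tmul c 1 * coact a} : Set (MinTensor C A))

namespace Action

variable {G : CompactQuantumGroup C} {A : Type u} [CStarAlgebra A]

/-- The fixed point algebra `A^G = {x | α(x) = 1 ⊗ x}`; its elements are called `G`-invariant. -/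
def fixedPoints (α : G.Action A) : Set A := {x | α.coact x = tmul 1 x}

/-- The convolution operator `(φ ⊗ ι) α : A → A` of a state `φ` on `C(G)`. -/
def convOp (α : G.Action A) (φ : State C) (x : A) : A := slice φ (α.coact x)

/-- `E` is a `G`-invariant conditional expectation of `A` onto `A^G`: a positive `A^G`-bimodule
projection onto `A^G` satisfying `(ι ⊗ E) α = 1 ⊗ E(·)`, the latter being expressed by applying
the states of `C(G)` to the first tensor factor. -/
structure IsInvariantCondExp [PartialOrder A] (α : G.Action A) (E : A →ₚ[ℂ] A) : Prop where
  map_mem : ∀ x, E x ∈ α.fixedPoints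
  map_of_mem : ∀ b ∈ α.fixedPoints, E b = b
  map_bimodule : ∀ b ∈ α.fixedPoints, ∀ b' ∈ α.fixedPoints, ∀ x, E (b * x * b') = b * E x * b'
  invariant : ∀ (φ : State C) (x : A), E (α.convOp φ x) = E x

end Action
end CompactQuantumGroup
end QuantumGroup
end CQG
end

/-! The conditional expectation is averaging over the Haar state, `E = (h ⊗ ι)α`. Invariance of `h`
together with coassociativity of `α` shows that `E` absorbs every convolution operator on either
side. Its range is then invariant because slices by states separate points of the minimal tensor
product (`eq_zero_of_slice`). Any other invariant expectation `F` satisfies `F x = F (E x) = E x`,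
which is uniqueness.

For a harmonic `x`, put `y = x - E x`. Then `P y = y` and `E y = 0`, and the goal is `y = 0`. With
`d = P₁ y - y`, the Kadison–Schwarz inequality for `P₁` and `P₂` gives `y*y + t d*d ≤ P(y*y)`
(`kadison_schwarz_convex`). Applying `E`, which commutes with `P`, the element `b = E(y*y)`
satisfies `b + t E(d*d) ≤ P b`. Choose a state attaining `‖b‖` at `b`. Since `b ≤ P b`, Cesàro
averaging along `P` yields a `P`-invariant state `ω` with `ω b ≥ ‖b‖` (`State.exists_invariant`).
Evaluating `ω` on the inequality forces `ψ(d*d) = 0` for the `G`-invariant state `ψ = ω ∘ E`.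

It remains to pass from `ν` to `h` (`apply_star_mul_self_eq_zero`). For `z = α(y) - 1 ⊗ y`,
invariance of `ψ` and `ψ(d*d) = 0` give `(ν ⊗ ψ)(z*z) = 0`. Faithfulness of `ν` kills `(ι ⊗
ψ)(z*z)`, hence also `(h ⊗ ψ)(z*z)`, which equals `2ψ(y*y)` because `E y = 0`. So `ω b = ψ(y*y) = 0`
and `b = 0`; faithfulness of `h` and injectivity of `α` give `y = 0`. -/

noncomputable section

namespace CQG

/-! ### States: separation of points, order, null vectors -/

section States

variable {A : Type u} [CStarAlgebra A]

/-- The vector state of a unit vector in a representation. -/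
def HilbertRep.vectorState (ρ : HilbertRep A) (ξ : ρ.space) (hξ : ‖ξ‖ = 1) : State A where
  toLinearMap :=
    { toFun := fun a => inner ℂ ξ (ρ.hom a ξ)
      map_add' := fun a b => by simp
      map_smul' := fun c a => by simp }
  map_one := by
    change inner ℂ ξ (ρ.hom 1 ξ) = 1
    rw [_root_.map_one]
    change inner ℂ ξ ξ = 1
    rw [inner_self_eq_norm_sq_to_K, hξ]
    simp
  nonneg a := by
    change 0 ≤ inner ℂ ξ (ρ.hom (star a * a) ξ)
    rw [map_mul, map_star, ContinuousLinearMap.star_eq_adjoint]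
    change 0 ≤ inner ℂ ξ ((ρ.hom a).adjoint (ρ.hom a ξ))
    rw [ContinuousLinearMap.adjoint_inner_right, inner_self_eq_norm_sq_to_K]
    exact Complex.zero_le_real.mpr (sq_nonneg _) |>.trans_eq (Complex.ofReal_pow _ _)

theorem HilbertRep.vectorState_apply (ρ : HilbertRep A) (ξ : ρ.space) (hξ : ‖ξ‖ = 1) (a : A) :
    ρ.vectorState ξ hξ a = inner ℂ ξ (ρ.hom a ξ) := rfl

/-- A quadratic identity on all of a Hilbert space follows from the one on unit vectors. -/
theorem forall_of_forall_unit {H : Type*} [NormedAddCommGroup H] [InnerProductSpace ℂ H]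
    {q : H → ℂ} (hq : ∀ (c : ℂ) ξ, q (c • ξ) = (star c * c) * q ξ)
    (h : ∀ ξ, ‖ξ‖ = 1 → q ξ = 0) (ξ : H) : q ξ = 0 := by
  rcases eq_or_ne ξ 0 with rfl | hne
  · simpa using hq 0 0
  · have hn : ‖ξ‖ ≠ 0 := norm_ne_zero_iff.mpr hne
    have h1 : ‖((‖ξ‖ : ℂ)⁻¹ : ℂ) • ξ‖ = 1 := by
      rw [norm_smul, norm_inv, Complex.norm_real, norm_norm, inv_mul_cancel₀ hn]
    have h2 : ξ = (‖ξ‖ : ℂ) • (((‖ξ‖ : ℂ)⁻¹ : ℂ) • ξ) := by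
      rw [smul_smul, mul_inv_cancel₀ (by exact_mod_cast hn), one_smul]
    rw [h2, hq, h _ h1, mul_zero]

/-- In a representation that preserves the norm of `a`, all vector states vanish on `a`; over `ℂ` an
operator with zero quadratic form is zero. -/
theorem eq_zero_of_forall_state {a : A} (h : ∀ φ : State A, φ a = 0) : a = 0 := by
  obtain ⟨ρ, hρ⟩ := exists_rep_norm a
  have h1 (ξ : ρ.space) : inner ℂ ξ (ρ.hom a ξ) = 0 := by
    refine forall_of_forall_unit (q := fun ξ => inner ℂ ξ (ρ.hom a ξ)) (fun c ξ => ?_)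
      (fun ξ hξ => ?_) ξ
    · simp only [map_smul, inner_smul_left, inner_smul_right]
      rw [← mul_assoc, mul_comm c]
      rfl
    · rw [← ρ.vectorState_apply ξ hξ]
      exact h _
  have h2 : (ρ.hom a : ρ.space →L[ℂ] ρ.space).toLinearMap = 0 := by
    refine (inner_map_self_eq_zero _).mp fun ξ => ?_
    rw [← inner_conj_symm]
    exact (congrArg (starRingEnd ℂ) (h1 ξ)).trans (map_zero _)
  have h3 : ρ.hom a = 0 := by
    ext ξ
    exact LinearMap.congr_fun h2 ξ
  rw [h3, norm_zero] at hρ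
  exact norm_le_zero_iff.mp hρ

theorem State.ext_of_forall {a b : A} (h : ∀ φ : State A, φ a = φ b) : a = b := by
  rw [← sub_eq_zero]
  exact eq_zero_of_forall_state fun φ => by rw [map_sub, h, sub_self]

theorem State.norm_apply_le (φ : State A) (a : A) : ‖φ a‖ ≤ ‖a‖ := by
  obtain ⟨π, ξ, hξ, h⟩ := φ.exists_rep
  rw [← h]
  refine (norm_inner_le_norm _ _).trans ?_
  rw [hξ, one_mul]
  refine (ContinuousLinearMap.le_opNorm _ _).trans ?_
  rw [hξ, mul_one]
  exact NonUnitalStarAlgHom.norm_apply_le _ a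

/-- A state as a continuous linear functional. -/
def State.toCLM (φ : State A) : A →L[ℂ] ℂ :=
  φ.toLinearMap.mkContinuous 1 fun a => by rw [one_mul]; exact φ.norm_apply_le a

theorem State.toCLM_apply (φ : State A) (a : A) : φ.toCLM a = φ a := rfl

theorem State.continuous (φ : State A) : Continuous fun a => φ a := φ.toCLM.continuous

theorem State.map_nonneg [PartialOrder A] [StarOrderedRing A] (φ : State A) {a : A} (ha : 0 ≤ a) :
    0 ≤ φ a := by
  obtain ⟨y, rfl⟩ := CStarAlgebra.nonneg_iff_eq_star_mul_self.mp ha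
  exact φ.nonneg y

theorem State.mono [PartialOrder A] [StarOrderedRing A] (φ : State A) {a b : A} (h : a ≤ b) :
    φ a ≤ φ b := by
  have := φ.map_nonneg (sub_nonneg.mpr h)
  rwa [map_sub, sub_nonneg] at this

theorem State.map_star (φ : State A) (a : A) : φ (star a) = star (φ a) := by
  obtain ⟨π, ξ, -, h⟩ := φ.exists_rep
  rw [← h, ← h, StarHomClass.map_star, ContinuousLinearMap.star_eq_adjoint,
    ContinuousLinearMap.adjoint_inner_right]
  exact (inner_conj_symm _ _).symm

/-- In the GNS representation the hypothesis says that `d` annihilates the cyclic vector. -/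
theorem State.null_left (φ : State A) {d : A} (hd : φ (star d * d) = 0) (y : A) :
    φ (star y * d) = 0 := by
  obtain ⟨π, ξ, -, h⟩ := φ.exists_rep
  have key (a b : A) : φ (star a * b) = inner ℂ (π.hom a ξ) (π.hom b ξ) := by
    rw [← h, map_mul, StarHomClass.map_star, ContinuousLinearMap.star_eq_adjoint]
    change inner ℂ ξ ((π.hom a).adjoint (π.hom b ξ)) = _
    rw [ContinuousLinearMap.adjoint_inner_right]
  have h0 : π.hom d ξ = 0 := inner_self_eq_zero.mp ((key d d).symm.trans hd)
  exact (key y d).trans (by rw [h0, inner_zero_right])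

theorem State.null_right (φ : State A) {d : A} (hd : φ (star d * d) = 0) (y : A) :
    φ (star d * y) = 0 := by
  have := φ.map_star (star y * d)
  rw [φ.null_left hd, star_mul, star_star, star_zero] at this
  exact this

theorem eq_zero_of_faithful [PartialOrder A] [StarOrderedRing A] {φ : State A} (hφ : φ.Faithful)
    {a : A} (ha : 0 ≤ a) (h : φ a = 0) : a = 0 := by
  obtain ⟨y, rfl⟩ := CStarAlgebra.nonneg_iff_eq_star_mul_self.mp ha
  rw [hφ y h, mul_zero]

end States

/-! ### Positivity from contractivity -/

section Contraction

/-- A unital, contractive and `*`-preserving linear map between C⋆-algebras is positive. -/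
theorem map_star_mul_self_nonneg_of_contractive {D B : Type*} [CStarAlgebra D] [CStarAlgebra B]
    [PartialOrder B] [StarOrderedRing B] {f : D →ₗ[ℂ] B} (h1 : f 1 = 1) (hf : ∀ x, ‖f x‖ ≤ ‖x‖)
    (hstar : ∀ x, f (star x) = star (f x)) (z : D) : 0 ≤ f (star z * z) := by
  let _ := CStarAlgebra.spectralOrder D
  let _ := CStarAlgebra.spectralOrderedRing D
  set a := star z * z with ha
  have ha0 : 0 ≤ a := star_mul_self_nonneg z
  have hsa : IsSelfAdjoint a := IsSelfAdjoint.of_nonneg ha0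
  have hfs : IsSelfAdjoint (f a) := by
    rw [IsSelfAdjoint, ← hstar, hsa.star_eq]
  -- For `0 ≤ a`, the element `‖a‖ - a` lies between `0` and `‖a‖`, so contractivity gives this
  -- bound. For the self-adjoint element `‖a‖ - f a` it means `‖a‖ - f a ≤ ‖a‖`, that is, `0 ≤ f a`.
  have hb : ‖algebraMap ℝ B ‖a‖ - f a‖ ≤ ‖a‖ := by
    have h2 : algebraMap ℝ B ‖a‖ - f a = f (algebraMap ℝ D ‖a‖ - a) := by
      rw [map_sub, Algebra.algebraMap_eq_smul_one, Algebra.algebraMap_eq_smul_one,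
        ← Complex.coe_smul, ← Complex.coe_smul, map_smul, h1]
    rw [h2]
    refine (hf _).trans ?_
    rw [CStarAlgebra.norm_le_iff_le_algebraMap _ (norm_nonneg a)
      (sub_nonneg.mpr hsa.le_algebraMap_norm_self)]
    exact sub_le_self _ ha0
  have hsb : IsSelfAdjoint (algebraMap ℝ B ‖a‖ - f a) :=
    (IsSelfAdjoint.algebraMap B (IsSelfAdjoint.all ‖a‖)).sub hfs
  have h3 := hsb.le_algebraMap_norm_self.trans
    (algebraMap_mono B hb)
  simpa using h3

end Contraction

/-! ### Left slice maps on the minimal tensor product -/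

section Slices

open MinTensor

variable {A B : Type u} [CStarAlgebra A] [CStarAlgebra B]

theorem MinTensor.norm_extendL_apply_le {D : Type u} [NormedAddCommGroup D] [NormedSpace ℂ D]
    [CompleteSpace D] {f : A ⊗[ℂ] B →ₗ[ℂ] D} (hf : ∀ x, ‖f x‖ ≤ minNorm x) (z : MinTensor A B) :
    ‖extendL f z‖ ≤ ‖z‖ := by
  refine denseRange_ofAlg.induction_on (p := fun z => ‖extendL f z‖ ≤ ‖z‖) z
    (isClosed_le (by fun_prop) (by fun_prop)) fun x => ?_
  rw [extendL_ofAlg hf, norm_ofAlg]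
  exact hf x

/-- Continuous functions on the minimal tensor product that agree on elementary tensors and
are additive are equal. -/
theorem MinTensor.eq_of_tmul {D : Type*} [AddCommGroup D] [TopologicalSpace D] [T2Space D]
    {f g : MinTensor A B → D} (hf : Continuous f) (hg : Continuous g)
    (hfa : ∀ x y, f (x + y) = f x + f y) (hga : ∀ x y, g (x + y) = g x + g y)
    (h : ∀ a b, f (tmul a b) = g (tmul a b)) (z : MinTensor A B) : f z = g z := by
  refine denseRange_ofAlg.induction_on (p := fun z => f z = g z) z (isClosed_eq hf hg) fun x => ?_
  have hf0 : f 0 = 0 := by simpa using hfa 0 0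
  have hg0 : g 0 = 0 := by simpa using hga 0 0
  induction x with
  | zero => rw [map_zero, hf0, hg0]
  | add x y hx hy => rw [map_add, hfa, hga, hx, hy]
  | tmul a b => exact h a b

theorem MinTensor.continuous_starAlgHom {D E : Type*} [CStarAlgebra D] [CStarAlgebra E]
    (f : D →⋆ₐ[ℂ] E) : Continuous f :=
  AddMonoidHomClass.continuous_of_bound f 1 fun x => by
    rw [one_mul]; exact NonUnitalStarAlgHom.norm_apply_le f x

theorem MinTensor.tmul_mul_tmul (a a' : A) (b b' : B) :
    (tmul a b : MinTensor A B) * tmul a' b' = tmul (a * a') (b * b') := by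
  rw [tmul, tmul, ← map_mul, Algebra.TensorProduct.tmul_mul_tmul, tmul]

theorem MinTensor.star_tmul (a : A) (b : B) :
    star (tmul a b : MinTensor A B) = tmul (star a) (star b) := by
  rw [tmul, ← map_star, TensorProduct.star_tmul, tmul]

theorem MinTensor.tmul_one_one : (tmul 1 1 : MinTensor A B) = 1 := by
  rw [tmul, ← Algebra.TensorProduct.one_def, map_one]

theorem norm_slice_le (φ : State A) (z : MinTensor A B) : ‖slice φ z‖ ≤ ‖z‖ :=
  norm_extendL_apply_le (norm_algSlice_le φ) z

theorem slice_one_tmul (φ : State A) (b : B) : slice φ (tmul 1 b) = b := by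
  rw [slice_tmul, φ.map_one, one_smul]

theorem slice_one (φ : State A) : slice φ (1 : MinTensor A B) = 1 := by
  rw [← tmul_one_one, slice_one_tmul]

theorem slice_star (φ : State A) (z : MinTensor A B) : slice φ (star z) = star (slice φ z) := by
  refine eq_of_tmul (f := fun z => slice φ (star z)) (g := fun z => star (slice φ z))
    (by fun_prop) (by fun_prop) (fun x y => by simp) (fun x y => by simp) (fun a b => ?_) z
  rw [star_tmul, slice_tmul, slice_tmul, φ.map_star, star_smul]

theorem slice_mul_one_tmul (φ : State A) (z : MinTensor A B) (b : B) :
    slice φ (z * tmul 1 b) = slice φ z * b := by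
  refine eq_of_tmul (f := fun z => slice φ (z * tmul 1 b)) (g := fun z => slice φ z * b)
    (by fun_prop) (by fun_prop) (fun x y => by simp [add_mul]) (fun x y => by simp [add_mul])
    (fun a b => ?_) z
  rw [tmul_mul_tmul, slice_tmul, slice_tmul, mul_one, smul_mul_assoc]

theorem slice_one_tmul_mul (φ : State A) (b : B) (z : MinTensor A B) :
    slice φ (tmul 1 b * z) = b * slice φ z := by
  refine eq_of_tmul (f := fun z => slice φ (tmul 1 b * z)) (g := fun z => b * slice φ z)
    (by fun_prop) (by fun_prop) (fun x y => by simp [mul_add]) (fun x y => by simp [mul_add])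
    (fun a b => ?_) z
  rw [tmul_mul_tmul, slice_tmul, slice_tmul, one_mul, mul_smul_comm]

theorem slice_map_id {D : Type u} [CStarAlgebra D] (φ : State A) (f : B →⋆ₐ[ℂ] D)
    (z : MinTensor A B) : slice φ (map (StarAlgHom.id ℂ A) f z) = f (slice φ z) := by
  have hf := continuous_starAlgHom f
  have hm := continuous_starAlgHom (map (StarAlgHom.id ℂ A) f)
  refine eq_of_tmul (f := fun z => slice φ (map (StarAlgHom.id ℂ A) f z))
    (g := fun z => f (slice φ z))
    (by fun_prop) (by fun_prop) (fun x y => by simp) (fun x y => by simp) (fun a b => ?_) z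
  rw [map_tmul, slice_tmul, slice_tmul, map_smul]
  rfl

theorem slice_star_mul_self_nonneg [PartialOrder B] [StarOrderedRing B] (φ : State A)
    (z : MinTensor A B) : 0 ≤ slice φ (star z * z) :=
  map_star_mul_self_nonneg_of_contractive (f := (slice φ : MinTensor A B →L[ℂ] B).toLinearMap)
    (slice_one φ) (norm_slice_le φ) (slice_star φ) z

/-! ### Right slice maps -/

/-- The slice map `ι ⊗ ψ : A ⊗ B → A` of a state `ψ` on the algebraic tensor product. -/
def algRightSlice (ψ : State B) : A ⊗[ℂ] B →ₗ[ℂ] A :=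
  TensorProduct.lift (LinearMap.flip (ψ.toLinearMap.smulRight (LinearMap.id : A →ₗ[ℂ] A)))

theorem algRightSlice_tmul (ψ : State B) (a : A) (b : B) :
    algRightSlice ψ (a ⊗ₜ b) = ψ b • a := rfl

theorem inner_prodRep_tmul_right {ψ : State B} {ρ : HilbertRep B} {ξ : ρ.space}
    (h : ∀ b, inner ℂ ξ (ρ.hom b ξ) = ψ b) (π : HilbertRep A) (x : A ⊗[ℂ] B) (k k' : π.space) :
    inner ℂ (k' ⊗ₜ[ℂ] ξ) (prodRep π ρ x (k ⊗ₜ[ℂ] ξ)) =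
      inner ℂ k' (π.hom (algRightSlice ψ x) k) := by
  induction x with
  | zero => simp
  | add x y hx hy => simp only [map_add, _root_.add_apply, inner_add_right, hx, hy]
  | tmul a b =>
    rw [prodRep_tmul, TensorProduct.mapL_tmul, TensorProduct.inner_tmul, h, algRightSlice_tmul,
      map_smul, _root_.smul_apply, inner_smul_right, mul_comm]

/-- The slice is the compression of `(π ⊗ ρ)(x)` by the isometry `k ↦ k ⊗ ξ`, where `ξ` is a GNS
vector of `ψ` and `π` preserves the norm of the slice. -/
theorem norm_algRightSlice_le (ψ : State B) (x : A ⊗[ℂ] B) :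
    ‖algRightSlice ψ x‖ ≤ minNorm x := by
  obtain ⟨π, hπ⟩ := exists_rep_norm (algRightSlice ψ x)
  obtain ⟨ρ, ξ, hξ, h⟩ := ψ.exists_rep
  have key := inner_prodRep_tmul_right h π x
  refine hπ.trans (le_trans ?_ (norm_prodRep_le π ρ x))
  refine ContinuousLinearMap.opNorm_le_bound _ (ContinuousLinearMap.opNorm_nonneg _) fun k => ?_
  set w := π.hom (algRightSlice ψ x) k with hw
  have hk (v : π.space) : ‖v ⊗ₜ[ℂ] ξ‖ = ‖v‖ := by
    rw [TensorProduct.norm_tmul, hξ, mul_one]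
  have h1 : ‖w‖ * ‖w‖ = ‖inner ℂ w w‖ := by
    rw [inner_self_eq_norm_sq_to_K, ← sq]
    simp
  have h2 : ‖w‖ * ‖w‖ ≤ ‖w‖ * ‖prodRep π ρ x (k ⊗ₜ[ℂ] ξ)‖ := by
    rw [h1, hw, ← key, ← hw, ← hk w]
    exact norm_inner_le_norm (𝕜 := ℂ) (w ⊗ₜ[ℂ] ξ) _
  have h3 : ‖prodRep π ρ x (k ⊗ₜ[ℂ] ξ)‖ ≤ ‖prodRep π ρ x‖ * ‖k‖ := by
    rw [← hk k]
    exact ContinuousLinearMap.le_opNorm _ _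
  rcases (norm_nonneg w).eq_or_lt with h0 | h0
  · rw [← h0]
    exact mul_nonneg (ContinuousLinearMap.opNorm_nonneg _) (norm_nonneg _)
  · exact (le_of_mul_le_mul_left h2 h0).trans h3

/-- The slice map `ι ⊗ ψ : A ⊗ B → A` of a state `ψ` on the minimal tensor product. -/
def rightSlice (ψ : State B) : MinTensor A B →L[ℂ] A :=
  MinTensor.extendL (algRightSlice ψ)

theorem rightSlice_tmul (ψ : State B) (a : A) (b : B) :
    rightSlice ψ (MinTensor.tmul a b) = ψ b • a :=
  MinTensor.extendL_ofAlg (norm_algRightSlice_le ψ) _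

theorem norm_rightSlice_le (ψ : State B) (z : MinTensor A B) : ‖rightSlice ψ z‖ ≤ ‖z‖ :=
  norm_extendL_apply_le (norm_algRightSlice_le ψ) z

theorem rightSlice_one (ψ : State B) : rightSlice ψ (1 : MinTensor A B) = 1 := by
  rw [← tmul_one_one, rightSlice_tmul, ψ.map_one, one_smul]

theorem rightSlice_star (ψ : State B) (z : MinTensor A B) :
    rightSlice ψ (star z) = star (rightSlice ψ z) := by
  refine eq_of_tmul (f := fun z => rightSlice ψ (star z)) (g := fun z => star (rightSlice ψ z))
    (by fun_prop) (by fun_prop) (fun x y => by simp) (fun x y => by simp) (fun a b => ?_) z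
  rw [star_tmul, rightSlice_tmul, rightSlice_tmul, ψ.map_star, star_smul]

theorem rightSlice_map_id {D : Type u} [CStarAlgebra D] (ψ : State B) (f : A →⋆ₐ[ℂ] D)
    (z : MinTensor A B) :
    rightSlice ψ (map f (StarAlgHom.id ℂ B) z) = f (rightSlice ψ z) := by
  have hf := continuous_starAlgHom f
  have hm := continuous_starAlgHom (map f (StarAlgHom.id ℂ B))
  refine eq_of_tmul (f := fun z => rightSlice ψ (map f (StarAlgHom.id ℂ B) z))
    (g := fun z => f (rightSlice ψ z))
    (by fun_prop) (by fun_prop) (fun x y => by simp) (fun x y => by simp) (fun a b => ?_) z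
  rw [map_tmul, rightSlice_tmul, rightSlice_tmul, map_smul]
  rfl

theorem rightSlice_star_mul_self_nonneg [PartialOrder A] [StarOrderedRing A] (ψ : State B)
    (z : MinTensor A B) : 0 ≤ rightSlice ψ (star z * z) :=
  map_star_mul_self_nonneg_of_contractive (f := (rightSlice ψ : MinTensor A B →L[ℂ] A).toLinearMap)
    (rightSlice_one ψ) (norm_rightSlice_le ψ) (rightSlice_star ψ) z

/-- A Fubini rule: both sides are the product functional `φ ⊗ ψ`. It lets faithfulness of a state on
the first leg be used after slicing the second. -/
theorem apply_slice_eq_apply_rightSlice (φ : State A) (ψ : State B) (z : MinTensor A B) :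
    ψ (slice φ z) = φ (rightSlice ψ z) := by
  refine eq_of_tmul (f := fun z => ψ.toCLM (slice φ z)) (g := fun z => φ.toCLM (rightSlice ψ z))
    (by fun_prop) (by fun_prop) (fun x y => by simp) (fun x y => by simp) (fun a b => ?_) z
  rw [slice_tmul, rightSlice_tmul, map_smul, map_smul, smul_eq_mul, smul_eq_mul,
    φ.toCLM_apply, ψ.toCLM_apply, mul_comm]

/-! ### Slice maps separate points -/

/-- The extension of `π ⊗ ρ` to the minimal tensor product, with values in the completion of the
Hilbert space tensor product. -/
def prodRepExt (π : HilbertRep A) (ρ : HilbertRep B) :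
    MinTensor A B →L[ℂ]
      (π.space ⊗[ℂ] ρ.space →L[ℂ] UniformSpace.Completion (π.space ⊗[ℂ] ρ.space)) :=
  MinTensor.extendL
    ((ContinuousLinearMap.compL ℂ (π.space ⊗[ℂ] ρ.space) (π.space ⊗[ℂ] ρ.space)
      (UniformSpace.Completion (π.space ⊗[ℂ] ρ.space))
      UniformSpace.Completion.toComplL).toLinearMap.comp (prodRep π ρ).toLinearMap)

theorem prodRepExt_bound (π : HilbertRep A) (ρ : HilbertRep B) (x : A ⊗[ℂ] B) :
    ‖((ContinuousLinearMap.compL ℂ (π.space ⊗[ℂ] ρ.space) (π.space ⊗[ℂ] ρ.space)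
      (UniformSpace.Completion (π.space ⊗[ℂ] ρ.space))
      UniformSpace.Completion.toComplL).toLinearMap.comp (prodRep π ρ).toLinearMap) x‖ ≤
      minNorm x := by
  refine le_trans ?_ (norm_prodRep_le π ρ x)
  refine ContinuousLinearMap.opNorm_le_bound _ (ContinuousLinearMap.opNorm_nonneg _) fun v => ?_
  change ‖((prodRep π ρ x v : π.space ⊗[ℂ] ρ.space) :
    UniformSpace.Completion (π.space ⊗[ℂ] ρ.space))‖ ≤ _
  rw [UniformSpace.Completion.norm_coe]
  exact ContinuousLinearMap.le_opNorm _ _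

theorem prodRepExt_ofAlg (π : HilbertRep A) (ρ : HilbertRep B) (x : A ⊗[ℂ] B)
    (v : π.space ⊗[ℂ] ρ.space) :
    prodRepExt π ρ (ofAlg x) v = ((prodRep π ρ x v : π.space ⊗[ℂ] ρ.space) :
      UniformSpace.Completion (π.space ⊗[ℂ] ρ.space)) := by
  rw [prodRepExt, extendL_ofAlg (prodRepExt_bound π ρ)]
  rfl

theorem norm_prodRepExt_le (π : HilbertRep A) (ρ : HilbertRep B) (z : MinTensor A B) :
    ‖prodRepExt π ρ z‖ ≤ ‖z‖ :=
  norm_extendL_apply_le (prodRepExt_bound π ρ) z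

theorem eq_zero_of_prodRepExt {z : MinTensor A B}
    (h : ∀ (π : HilbertRep A) (ρ : HilbertRep B), prodRepExt π ρ z = 0) : z = 0 := by
  rw [← norm_le_zero_iff]
  refine le_of_forall_pos_le_add fun ε hε => ?_
  obtain ⟨x, hx⟩ := denseRange_ofAlg.exists_dist_lt z (half_pos hε)
  rw [dist_eq_norm] at hx
  -- Every `π ⊗ ρ` kills `z`, so on the approximant `x` it only sees `x - z`, uniformly in `π` and
  -- `ρ`.
  have h1 : minNorm x ≤ ε / 2 := by
    refine minNorm_le fun π ρ => ContinuousLinearMap.opNorm_le_bound _ (half_pos hε).le fun v => ?_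
    rw [← UniformSpace.Completion.norm_coe, ← prodRepExt_ofAlg]
    have h2 : prodRepExt π ρ (ofAlg x) = -prodRepExt π ρ (z - ofAlg x) := by
      rw [map_sub, h, zero_sub, neg_neg]
    rw [h2, _root_.neg_apply, norm_neg]
    refine (ContinuousLinearMap.le_opNorm _ _).trans
      (mul_le_mul_of_nonneg_right ?_ (norm_nonneg _))
    exact (norm_prodRepExt_le π ρ _).trans hx.le
  calc ‖z‖ = ‖(z - ofAlg x) + ofAlg x‖ := by rw [sub_add_cancel]
    _ ≤ ‖z - ofAlg x‖ + ‖ofAlg x‖ := norm_add_le _ _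
    _ ≤ ε / 2 + ε / 2 := add_le_add hx.le (by rw [norm_ofAlg]; exact h1)
    _ = 0 + ε := by ring

theorem inner_prodRepExt_tmul {φ : State A} {π : HilbertRep A} {ξ : π.space}
    (h : ∀ a, inner ℂ ξ (π.hom a ξ) = φ a) (ρ : HilbertRep B) (z : MinTensor A B)
    (k k' : ρ.space) :
    inner ℂ ((ξ ⊗ₜ[ℂ] k' : π.space ⊗[ℂ] ρ.space) :
      UniformSpace.Completion (π.space ⊗[ℂ] ρ.space)) (prodRepExt π ρ z (ξ ⊗ₜ[ℂ] k)) =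
      inner ℂ k' (ρ.hom (slice φ z) k) := by
  have hρ := continuous_starAlgHom ρ.hom
  refine denseRange_ofAlg.induction_on (p := fun z => inner ℂ ((ξ ⊗ₜ[ℂ] k' : π.space ⊗[ℂ] ρ.space) :
      UniformSpace.Completion (π.space ⊗[ℂ] ρ.space)) (prodRepExt π ρ z (ξ ⊗ₜ[ℂ] k)) =
      inner ℂ k' (ρ.hom (slice φ z) k)) z (isClosed_eq (by fun_prop) (by fun_prop)) fun x => ?_
  rw [prodRepExt_ofAlg, UniformSpace.Completion.inner_coe, inner_prodRep_tmul h, slice_ofAlg]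

/-- A sesquilinear expression that vanishes on the diagonal vanishes. -/
theorem sesq_eq_zero {H : Type*} [AddCommGroup H] [Module ℂ H] {q : H → H → ℂ}
    (hal : ∀ x y z, q (x + y) z = q x z + q y z) (har : ∀ x y z, q x (y + z) = q x y + q x z)
    (hsl : ∀ (c : ℂ) x y, q (c • x) y = star c * q x y)
    (hsr : ∀ (c : ℂ) x y, q x (c • y) = c * q x y)
    (h : ∀ x, q x x = 0) (x y : H) : q x y = 0 := by
  have h1 := h (x + y)
  have h2 := h (x + Complex.I • y)
  simp only [hal, har, hsl, hsr, h] at h1 h2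
  have h3 : star Complex.I = -Complex.I := Complex.conj_I
  rw [h3] at h2
  -- The two diagonal values give `q x y + q y x = 0` and `I * (q x y - q y x) = 0`; this
  -- combination eliminates `q y x`.
  have h4 : Complex.I * (2 * q x y) = 0 := by linear_combination h2 + Complex.I * h1
  simpa [Complex.I_ne_zero] using h4

/-- The slice maps of states separate the points of the minimal tensor product. -/
theorem eq_zero_of_slice {z : MinTensor A B} (h : ∀ φ : State A, slice φ z = 0) : z = 0 := by
  refine eq_zero_of_prodRepExt fun π ρ => ?_
  -- States only control matrix coefficients with the same vector on the first leg. Polarization in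
  -- `ξ', ξ`, with `k, k'` fixed, recovers the others.
  have key (k k' : ρ.space) (ξ' ξ : π.space) :
      inner ℂ ((ξ' ⊗ₜ[ℂ] k' : π.space ⊗[ℂ] ρ.space) :
        UniformSpace.Completion (π.space ⊗[ℂ] ρ.space)) (prodRepExt π ρ z (ξ ⊗ₜ[ℂ] k)) = 0 := by
    refine sesq_eq_zero (q := fun ξ' ξ => inner ℂ ((ξ' ⊗ₜ[ℂ] k' : π.space ⊗[ℂ] ρ.space) :
        UniformSpace.Completion (π.space ⊗[ℂ] ρ.space)) (prodRepExt π ρ z (ξ ⊗ₜ[ℂ] k)))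
      (fun x y w => ?_) (fun x y w => ?_) (fun c x y => ?_) (fun c x y => ?_) ?_ ξ' ξ
    · rw [TensorProduct.add_tmul, UniformSpace.Completion.coe_add, inner_add_left]
    · rw [TensorProduct.add_tmul, map_add, inner_add_right]
    · rw [← TensorProduct.smul_tmul', UniformSpace.Completion.coe_smul, inner_smul_left]
      rfl
    · rw [← TensorProduct.smul_tmul', map_smul, inner_smul_right]
    · refine forall_of_forall_unit (fun c ξ => ?_) fun ξ hξ => ?_
      · rw [← TensorProduct.smul_tmul', ← TensorProduct.smul_tmul',
          UniformSpace.Completion.coe_smul, map_smul, inner_smul_left, inner_smul_right, ← mul_assoc]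
        rfl
      · have h1 := inner_prodRepExt_tmul (φ := π.vectorState ξ hξ) (fun _ => rfl) ρ z k k'
        rw [h, map_zero] at h1
        exact h1.trans (inner_zero_right _)
  have key2 (v w : π.space ⊗[ℂ] ρ.space) :
      inner ℂ (v : UniformSpace.Completion (π.space ⊗[ℂ] ρ.space)) (prodRepExt π ρ z w) = 0 := by
    induction v with
    | zero => rw [UniformSpace.Completion.coe_zero, inner_zero_left]
    | add v v' hv hv' => rw [UniformSpace.Completion.coe_add, inner_add_left, hv, hv', add_zero]
    | tmul ξ' k' =>
      induction w with
      | zero => rw [map_zero, inner_zero_right]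
      | add v v' hv hv' => rw [map_add, inner_add_right, hv, hv', add_zero]
      | tmul ξ k => exact key k k' ξ' ξ
  ext w
  have h3 : inner ℂ (prodRepExt π ρ z w) (prodRepExt π ρ z w) = 0 :=
    UniformSpace.Completion.induction_on (p := fun v => inner ℂ v (prodRepExt π ρ z w) = 0)
      (prodRepExt π ρ z w) (isClosed_eq (by fun_prop) (by fun_prop)) fun v => key2 v w
  exact inner_self_eq_zero.mp h3

end Slices

end CQG

/-! ### Convolution operators and averaging over the Haar state -/

namespace CQG

open MinTensor

/-- The product functional `χ ⊗ φ ⊗ ω` has the same value on corresponding elementary tensors, and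
by linearity and continuity this passes to the closed span defining `AssocRel`. -/
theorem AssocRel.apply_slices {A B D : Type u} [CStarAlgebra A] [CStarAlgebra B] [CStarAlgebra D]
    {u : MinTensor (MinTensor A B) D} {v : MinTensor A (MinTensor B D)} (huv : AssocRel u v)
    (χ : State A) (φ : State B) (ω : State D) :
    φ (slice χ (rightSlice ω u)) = ω (slice φ (slice χ v)) := by
  let F : MinTensor (MinTensor A B) D × MinTensor A (MinTensor B D) →L[ℂ] ℂ :=
    (φ.toCLM.comp ((slice χ).comp (rightSlice ω))).comp (ContinuousLinearMap.fst ℂ _ _) -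
    (ω.toCLM.comp ((slice φ).comp (slice χ))).comp (ContinuousLinearMap.snd ℂ _ _)
  have hF (p : MinTensor (MinTensor A B) D × MinTensor A (MinTensor B D)) :
      F p = φ (slice χ (rightSlice ω p.1)) - ω (slice φ (slice χ p.2)) := rfl
  suffices h : F (u, v) = 0 by
    rw [hF] at h
    exact sub_eq_zero.mp h
  refine closure_minimal (t := {p | F p = 0}) ?_ (isClosed_eq F.continuous continuous_const) huv
  intro p hp
  induction hp using Submodule.span_induction with
  | mem p hp =>
    obtain ⟨a, b, d, rfl⟩ := hp
    change F _ = 0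
    rw [hF]
    dsimp only
    rw [rightSlice_tmul, map_smul, slice_tmul, slice_tmul, map_smul, map_smul, map_smul,
      slice_tmul, map_smul, map_smul]
    simp only [smul_eq_mul]
    ring
  | zero => exact map_zero F
  | add x y _ _ hx hy => exact (map_add F x y).trans (by rw [hx, hy, add_zero])
  | smul c x _ hx => exact (map_smul F c x).trans (by rw [hx, smul_zero])

namespace CompactQuantumGroup.Action

variable {C A : Type u} [CStarAlgebra C] [CStarAlgebra A] {G : CompactQuantumGroup C}
  (α : G.Action A)

theorem apply_convOp (φ : State C) (ω : State A) (x : A) :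
    ω (α.convOp φ x) = φ (rightSlice ω (α.coact x)) :=
  apply_slice_eq_apply_rightSlice _ _ _

/-- Coassociativity of the action, tested against product states. The operator applied first becomes
the left factor of the convolution. -/
theorem apply_convOp_convOp (χ φ : State C) (ω : State A) (x : A) :
    ω (α.convOp φ (α.convOp χ x)) = G.conv χ φ (rightSlice ω (α.coact x)) := by
  have h := (α.coassoc x).apply_slices χ φ ω
  rw [rightSlice_map_id, slice_map_id] at h
  exact h.symm

theorem convOp_add (φ : State C) (x y : A) :
    α.convOp φ (x + y) = α.convOp φ x + α.convOp φ y := by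
  rw [convOp, map_add, map_add]
  rfl

theorem convOp_smul (φ : State C) (c : ℂ) (x : A) :
    α.convOp φ (c • x) = c • α.convOp φ x := by
  rw [convOp, map_smul, map_smul]
  rfl

theorem convOp_of_mem (φ : State C) {b : A} (hb : b ∈ α.fixedPoints) : α.convOp φ b = b := by
  have hb' : α.coact b = tmul 1 b := hb
  rw [convOp, hb', slice_one_tmul]

theorem mem_fixedPoints_of_convOp {b : A} (hb : ∀ φ, α.convOp φ b = b) : b ∈ α.fixedPoints := by
  change α.coact b = tmul 1 b
  rw [← sub_eq_zero]
  refine eq_zero_of_slice fun φ => ?_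
  rw [map_sub, slice_one_tmul, sub_eq_zero]
  exact hb φ

theorem convOp_bimodule (φ : State C) {b b' : A} (hb : b ∈ α.fixedPoints)
    (hb' : b' ∈ α.fixedPoints) (x : A) :
    α.convOp φ (b * x * b') = b * α.convOp φ x * b' := by
  have h1 : α.coact b = tmul 1 b := hb
  have h2 : α.coact b' = tmul 1 b' := hb'
  rw [convOp, map_mul α.coact, map_mul α.coact, h1, h2, slice_mul_one_tmul, slice_one_tmul_mul]
  rfl

theorem convOp_star_mul_self_nonneg [PartialOrder A] [StarOrderedRing A] (φ : State C) (x : A) :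
    0 ≤ α.convOp φ (star x * x) := by
  rw [convOp, map_mul, map_star]
  exact slice_star_mul_self_nonneg φ _

variable {h : State C} (hh : G.IsHaarState h)
include hh

theorem convOp_haar_convOp (φ : State C) (x : A) :
    α.convOp h (α.convOp φ x) = α.convOp h x :=
  State.ext_of_forall fun ω => by
    rw [apply_convOp_convOp, (hh φ _).1, apply_convOp]

theorem convOp_convOp_haar (φ : State C) (x : A) :
    α.convOp φ (α.convOp h x) = α.convOp h x :=
  State.ext_of_forall fun ω => by
    rw [apply_convOp_convOp, (hh φ _).2, apply_convOp]

theorem convOp_haar_mem (x : A) : α.convOp h x ∈ α.fixedPoints :=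
  α.mem_fixedPoints_of_convOp fun φ => α.convOp_convOp_haar hh φ x

omit hh in
/-- The convolution operator `(φ ⊗ ι) α` as a positive map. -/
def convOpPositive [PartialOrder A] [StarOrderedRing A] (φ : State C) : A →ₚ[ℂ] A :=
  PositiveLinearMap.mk₀
    { toFun := α.convOp φ
      map_add' := α.convOp_add φ
      map_smul' := α.convOp_smul φ } fun x hx => by
    obtain ⟨y, rfl⟩ := CStarAlgebra.nonneg_iff_eq_star_mul_self.mp hx
    exact α.convOp_star_mul_self_nonneg φ y

theorem isInvariantCondExp_convOpPositive [PartialOrder A] [StarOrderedRing A] :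
    α.IsInvariantCondExp (α.convOpPositive h) where
  map_mem := α.convOp_haar_mem hh
  map_of_mem _ hb := α.convOp_of_mem h hb
  map_bimodule _ hb _ hb' := α.convOp_bimodule h hb hb'
  invariant := α.convOp_haar_convOp hh

/-- Uniqueness: `E` is unchanged by first averaging over `h`, and it fixes the average, which is
already invariant. -/
theorem IsInvariantCondExp.apply_eq [PartialOrder A] {E : A →ₚ[ℂ] A}
    (hE : α.IsInvariantCondExp E) (x : A) : E x = α.convOp h x := by
  rw [← hE.invariant h x]
  exact hE.map_of_mem _ (α.convOp_haar_mem hh x)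

omit hh in
/-- The averaging over a faithful state is faithful. -/
theorem eq_zero_of_convOp_star_mul_self (hfaithful : h.Faithful) {y : A}
    (hy : α.convOp h (star y * y) = 0) : y = 0 := by
  let _ := CStarAlgebra.spectralOrder C
  let _ := CStarAlgebra.spectralOrderedRing C
  have hz : star (α.coact y) * α.coact y = 0 := by
    refine eq_zero_of_slice fun φ => State.ext_of_forall fun ω => ?_
    -- Slicing by `ω` first leaves a positive element of `C(G)` on which `h` vanishes, so
    -- faithfulness applies.
    have h1 : rightSlice ω (star (α.coact y) * α.coact y) = 0 := by
      refine eq_zero_of_faithful hfaithful (rightSlice_star_mul_self_nonneg ω _) ?_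
      rw [← apply_slice_eq_apply_rightSlice, ← map_star, ← map_mul]
      change ω (α.convOp h (star y * y)) = 0
      rw [hy, map_zero]
    rw [apply_slice_eq_apply_rightSlice, h1, map_zero, map_zero]
  have hz' : α.coact y = 0 := CStarRing.star_mul_self_eq_zero_iff _ |>.mp hz
  exact α.injective (hz'.trans (map_zero _).symm)

omit hh in
/-- If `ψ` is an invariant state, `ν` is a faithful state on `C(G)` and `(ν ⊗ ι) α` fixes `y` in
`L²(A, ψ)`, while the average of `y` vanishes, then `y` vanishes in `L²(A, ψ)`. -/
theorem apply_star_mul_self_eq_zero {ν : State C} (hν : ν.Faithful) {ψ : State A}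
    (hψ : ∀ φ x, ψ (α.convOp φ x) = ψ x) {y : A} (hy : α.convOp h y = 0)
    (hd : ψ (star (α.convOp ν y - y) * (α.convOp ν y - y)) = 0) : ψ (star y * y) = 0 := by
  let _ := CStarAlgebra.spectralOrder C
  let _ := CStarAlgebra.spectralOrderedRing C
  set z : MinTensor C A := α.coact y - tmul 1 y with hz
  -- Stated for all `φ` because it is used twice: with `ν`, where the right side vanishes, and with
  -- `h`, where the cross terms vanish.
  have hzz (φ : State C) : ψ (slice φ (star z * z)) =
      ψ (star y * y) - ψ (star (α.convOp φ y) * y) - ψ (star y * α.convOp φ y) +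
        ψ (star y * y) := by
    have h1 : star z * z = α.coact (star y * y) - star (α.coact y) * tmul 1 y -
        tmul 1 (star y) * α.coact y + tmul 1 (star y * y) := by
      have h2 : (tmul 1 (star y * y) : MinTensor C A) = tmul 1 (star y) * tmul 1 y := by
        rw [tmul_mul_tmul, one_mul]
      rw [hz, star_sub, star_tmul, star_one, h2, map_mul, map_star]
      noncomm_ring
    rw [h1, map_add, map_sub, map_sub, slice_mul_one_tmul, slice_one_tmul_mul, slice_one_tmul,
      slice_star, map_add, map_sub, map_sub]
    change ψ (α.convOp φ (star y * y)) - _ - _ + _ = _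
    rw [hψ]
    rfl
  have h1 : ψ (slice ν (star z * z)) = 0 := by
    rw [hzz]
    -- Modulo `ψ`-null vectors `(ν ⊗ ι)α(y)` is `y`, so all four terms cancel.
    have h2 : α.convOp ν y = (α.convOp ν y - y) + y := by rw [sub_add_cancel]
    rw [h2, star_add, add_mul, mul_add, map_add, map_add, ψ.null_left hd, ψ.null_right hd]
    ring
  have h2 : rightSlice ψ (star z * z) = 0 := by
    refine eq_zero_of_faithful hν (rightSlice_star_mul_self_nonneg ψ z) ?_
    rw [← apply_slice_eq_apply_rightSlice, h1]
  have h3 : ψ (slice h (star z * z)) = 0 := by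
    rw [apply_slice_eq_apply_rightSlice, h2, map_zero]
  rw [hzz, hy, star_zero, zero_mul, mul_zero, map_zero, sub_zero, sub_zero] at h3
  have h4 : (2 : ℂ) * ψ (star y * y) = 0 := by linear_combination h3
  simpa using h4

end CompactQuantumGroup.Action

/-! ### Kadison–Schwarz inequalities -/

section KadisonSchwarz

variable {A B : Type*} [CStarAlgebra A] [PartialOrder A] [StarOrderedRing A]
  [CStarAlgebra B] [PartialOrder B] [StarOrderedRing B]

/-- This is the quadratic form of `M` at the column `(1, c)`; for `M = N*N` it is the sum of the
squares of the entries of `N (1, c)`. -/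
theorem cstarMatrix_quadratic_nonneg {M : CStarMatrix (Fin 2) (Fin 2) A} (hM : 0 ≤ M) (c : A) :
    0 ≤ M 0 0 + M 0 1 * c + star c * M 1 0 + star c * M 1 1 * c := by
  rw [StarOrderedRing.nonneg_iff] at hM
  induction hM using AddSubmonoid.closure_induction with
  | zero => simp [CStarMatrix.zero_apply]
  | add M M' _ _ hM hM' =>
    refine (add_nonneg hM hM').trans_eq ?_
    simp only [CStarMatrix.add_apply]
    noncomm_ring
  | mem M hM =>
  obtain ⟨N, rfl⟩ := hM
  dsimp only
  have h1 : (star N * N) 0 0 + (star N * N) 0 1 * c + star c * (star N * N) 1 0 +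
      star c * (star N * N) 1 1 * c =
      star (N 0 0 + N 0 1 * c) * (N 0 0 + N 0 1 * c) +
        star (N 1 0 + N 1 1 * c) * (N 1 0 + N 1 1 * c) := by
    simp only [CStarMatrix.mul_apply, Fin.sum_univ_two, CStarMatrix.star_apply, star_add, star_mul]
    noncomm_ring
  rw [h1]
  exact add_nonneg (star_mul_self_nonneg _) (star_mul_self_nonneg _)

theorem kadison_schwarz (P : A →CP B) (hP : P 1 = 1) (y : A) :
    star (P y) * P y ≤ P (star y * y) := by
  -- `N*N` has rows `(y*y, y*)` and `(y, 1)`. Its entrywise image under `P` is positive, and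
  -- evaluating at `(1, -P y)` completes the square.
  let N : CStarMatrix (Fin 2) (Fin 2) A := CStarMatrix.ofMatrix !![y, 1; 0, 0]
  have hM := P.map_cstarMatrix_nonneg (star N * N) (star_mul_self_nonneg N)
  have h1 := cstarMatrix_quadratic_nonneg hM (-P y)
  have hs : P (star y) = star (P y) := map_star P y
  have h00 : (star N * N) 0 0 = star y * y := by
    simp [N, CStarMatrix.mul_apply, CStarMatrix.star_apply]
  have h01 : (star N * N) 0 1 = star y := by
    simp [N, CStarMatrix.mul_apply, CStarMatrix.star_apply]
  have h10 : (star N * N) 1 0 = y := by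
    simp [N, CStarMatrix.mul_apply, CStarMatrix.star_apply]
  have h11 : (star N * N) 1 1 = 1 := by
    simp [N, CStarMatrix.mul_apply, CStarMatrix.star_apply]
  simp only [CStarMatrix.map_apply, h00, h01, h10, h11, hP, hs] at h1
  rw [← sub_nonneg]
  convert h1 using 1
  rw [star_neg]
  noncomm_ring

/-- A sharpened Kadison–Schwarz inequality for a fixed point of a convex combination of ucp maps. -/
theorem kadison_schwarz_convex {P P₁ P₂ : A →CP A} {t : ℝ} (h1 : P₁ 1 = 1) (h2 : P₂ 1 = 1)
    (ht0 : 0 < t) (ht1 : t < 1)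
    (hP : ∀ x, P x = (t : ℂ) • P₁ x + ((1 - t : ℝ) : ℂ) • P₂ x) {y : A} (hy : P y = y) :
    star y * y + t • (star (P₁ y - y) * (P₁ y - y)) ≤ P (star y * y) := by
  have ht2 : 0 < 1 - t := sub_pos.mpr ht1
  have hP' (x : A) : P x = t • P₁ x + (1 - t) • P₂ x := by
    rw [hP, Complex.coe_smul, Complex.coe_smul]
  have hle : t • (star (P₁ y) * P₁ y) + (1 - t) • (star (P₂ y) * P₂ y) ≤ P (star y * y) := by
    rw [hP']
    exact add_le_add (smul_le_smul_of_nonneg_left (kadison_schwarz P₁ h1 y) ht0.le)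
      (smul_le_smul_of_nonneg_left (kadison_schwarz P₂ h2 y) ht2.le)
  refine le_trans ?_ hle
  set d := P₁ y - y with hd
  have hp1 : P₁ y = y + d := by rw [hd]; abel
  set e := P₂ y - y with he
  have hp2 : P₂ y = y + e := by rw [he]; abel
  -- The deviations average to zero because `P y = y`, so the cross terms cancel below and only
  -- `d*d` and `e*e` survive.
  have hde : t • d + (1 - t) • e = 0 := by
    have h3 := hP' y
    rw [hy, hp1, hp2] at h3
    have h4 : t • (y + d) + (1 - t) • (y + e) = y + (t • d + (1 - t) • e) := by module
    rw [h4] at h3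
    exact left_eq_add.mp h3
  have hde' : t • star d + (1 - t) • star e = 0 := by
    have := congrArg star hde
    simpa using this
  rw [hp1, hp2]
  have h5 : t • (star (y + d) * (y + d)) + (1 - t) • (star (y + e) * (y + e)) =
      star y * y + t • (star d * d) + (1 - t) • (star e * e) := by
    have h6 : star y * (t • d + (1 - t) • e) = 0 := by rw [hde, mul_zero]
    have h7 : (t • star d + (1 - t) • star e) * y = 0 := by rw [hde', zero_mul]
    rw [mul_add, mul_smul_comm, mul_smul_comm] at h6
    rw [add_mul, smul_mul_assoc, smul_mul_assoc] at h7
    have h8 : t • (star (y + d) * (y + d)) + (1 - t) • (star (y + e) * (y + e)) =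
        star y * y + t • (star d * d) + (1 - t) • (star e * e) +
        (t • (star y * d) + (1 - t) • (star y * e)) +
        (t • (star d * y) + (1 - t) • (star e * y)) := by
      simp only [star_add, add_mul, mul_add]
      module
    rw [h8, h6, h7, add_zero, add_zero]
  rw [h5]
  exact le_add_of_nonneg_right (smul_nonneg ht2.le (star_mul_self_nonneg e))

end KadisonSchwarz

/-! ### Invariant states from Cesàro means -/

section InvariantState

variable {A : Type u} [CStarAlgebra A] [PartialOrder A] [StarOrderedRing A]

/-- The composition of a state with a unital positive map. -/
def State.comp (ω : State A) (P : A →ₗ[ℂ] A) (h1 : P 1 = 1) (hP : ∀ a, 0 ≤ P (star a * a)) :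
    State A where
  toLinearMap := ω.toLinearMap.comp P
  map_one := by rw [LinearMap.comp_apply, h1, ω.map_one]
  nonneg a := ω.map_nonneg (hP a)

/-- For a unital positive map `P` and a state `ω₀`, an ultrafilter limit of the Cesàro means of
`ω₀ ∘ P ^ k` is a `P`-invariant state, and its value at any `b ≤ P b` is at least `ω₀ b`. -/
theorem State.exists_invariant (P : A →ₗ[ℂ] A) (h1 : P 1 = 1) (hP : ∀ a, 0 ≤ a → 0 ≤ P a)
    (ω₀ : State A) :
    ∃ ω : State A, (∀ x, ω (P x) = ω x) ∧ ∀ b, b ≤ P b → ω₀ b ≤ ω b := by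
  have hk1 (k : ℕ) : (P ^ k) 1 = 1 := by
    induction k with
    | zero => rfl
    | succ k ih => rw [pow_succ', Module.End.mul_apply, ih, h1]
  have hkP (k : ℕ) (a : A) (ha : 0 ≤ a) : 0 ≤ (P ^ k) a := by
    induction k with
    | zero => exact ha
    | succ k ih => rw [pow_succ', Module.End.mul_apply]; exact hP _ ih
  let s (k : ℕ) : State A := ω₀.comp (P ^ k) (hk1 k) fun a => hkP k _ (star_mul_self_nonneg a)
  have hs (k : ℕ) (a : A) : s k a = ω₀ ((P ^ k) a) := rfl
  let m (n : ℕ) : A →ₗ[ℂ] ℂ := ((n + 1 : ℂ)⁻¹) • ∑ k ∈ Finset.range (n + 1), (s k).toLinearMap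
  have hm (n : ℕ) (a : A) : m n a = (n + 1 : ℂ)⁻¹ * ∑ k ∈ Finset.range (n + 1), s k a := by
    simp only [m, LinearMap.smul_apply, LinearMap.sum_apply, smul_eq_mul]
  have hpos (n : ℕ) : (0 : ℂ) ≤ (n + 1 : ℂ)⁻¹ := by
    have : (0 : ℝ) ≤ ((n : ℝ) + 1)⁻¹ := by positivity
    have h2 := Complex.zero_le_real.mpr this
    push_cast at h2
    exact h2
  have hne (n : ℕ) : (n + 1 : ℂ) ≠ 0 := Nat.cast_add_one_ne_zero n
  have hnorm (n : ℕ) : ‖(n + 1 : ℂ)⁻¹‖ = ((n : ℝ) + 1)⁻¹ := by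
    rw [norm_inv]
    congr 1
    exact_mod_cast Complex.norm_natCast (n + 1)
  have hbound (n : ℕ) (a : A) : ‖m n a‖ ≤ ‖a‖ := by
    rw [hm, norm_mul, hnorm]
    have h2 : ‖∑ k ∈ Finset.range (n + 1), s k a‖ ≤ ((n : ℝ) + 1) * ‖a‖ := by
      refine (norm_sum_le_of_le _ fun k _ => (s k).norm_apply_le a).trans ?_
      simp
    rw [inv_mul_le_iff₀ (by positivity)]
    exact h2
  -- One ultrafilter makes the bounded sequences `m n a` converge for all `a` at once, so the limit
  -- is linear in `a`. It refines `atTop`, so ordinary limits are kept.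
  let U : Ultrafilter ℕ := Filter.hyperfilter ℕ
  have hU : (U : Filter ℕ) ≤ Filter.atTop := by
    rw [← Nat.cofinite_eq_atTop]
    exact Filter.hyperfilter_le_cofinite
  have hlim (a : A) : ∃ l : ℂ, Filter.Tendsto (fun n => m n a) U (nhds l) := by
    obtain ⟨l, -, hl⟩ := (isCompact_closedBall (0 : ℂ) ‖a‖).ultrafilter_le_nhds'
      (U.map fun n => m n a) (Ultrafilter.mem_map.mpr
        (Filter.Eventually.of_forall fun n => mem_closedBall_zero_iff.mpr (hbound n a)))
    exact ⟨l, hl⟩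
  choose f hf using hlim
  have huniq {a : A} {l : ℂ} (h2 : Filter.Tendsto (fun n => m n a) U (nhds l)) : f a = l :=
    tendsto_nhds_unique (hf a) h2
  let ω : State A :=
    { toLinearMap :=
        { toFun := f
          map_add' := fun a b => huniq (by simpa using (hf a).add (hf b))
          map_smul' := fun c a => huniq (by simpa using (hf a).const_mul c) }
      map_one := huniq (by
        refine tendsto_const_nhds.congr fun n => ?_
        rw [hm]
        simp only [State.map_one, Finset.sum_const, Finset.card_range, nsmul_eq_mul, mul_one]
        push_cast
        exact (inv_mul_cancel₀ (hne n)).symm)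
      nonneg := fun a => ge_of_tendsto' (hf _) fun n => by
        rw [hm]
        exact mul_nonneg (hpos n) (Finset.sum_nonneg fun k _ => (s k).nonneg a) }
  have hω (a : A) : ω a = f a := rfl
  refine ⟨ω, fun x => ?_, fun b hb => ?_⟩
  · rw [hω, hω]
    -- Replacing `x` by `P x` shifts the sum by one, so it telescopes to two bounded end terms.
    have h2 (n : ℕ) : m n (P x) - m n x = (n + 1 : ℂ)⁻¹ * (s (n + 1) x - ω₀ x) := by
      rw [hm, hm, ← mul_sub, ← Finset.sum_sub_distrib]
      congr 1
      have h3 (k : ℕ) : s k (P x) = s (k + 1) x := by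
        rw [hs, hs, pow_succ, Module.End.mul_apply]
      simp only [h3]
      rw [Finset.sum_range_sub (fun k => s k x)]
      rfl
    have h4 : Filter.Tendsto (fun n => m n (P x) - m n x) Filter.atTop (nhds 0) := by
      refine squeeze_zero_norm (a := fun n : ℕ => (1 / ((n : ℝ) + 1)) * (2 * ‖x‖)) (fun n => ?_) ?_
      · rw [h2, norm_mul, hnorm, one_div]
        refine mul_le_mul_of_nonneg_left ?_ (by positivity)
        refine (norm_sub_le _ _).trans ?_
        have := (s (n + 1)).norm_apply_le x
        have := ω₀.norm_apply_le x
        linarith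
      · simpa using tendsto_one_div_add_atTop_nhds_zero_nat.mul_const (2 * ‖x‖)
    exact sub_eq_zero.mp (tendsto_nhds_unique ((hf (P x)).sub (hf x)) (h4.mono_left hU))
  · rw [hω]
    have hmono (k : ℕ) : b ≤ (P ^ k) b := by
      induction k with
      | zero => exact le_rfl
      | succ k ih =>
        refine ih.trans ?_
        have := hkP k _ (sub_nonneg.mpr hb)
        rw [map_sub, sub_nonneg] at this
        rw [pow_succ, Module.End.mul_apply]
        exact this
    refine ge_of_tendsto' (hf b) fun n => ?_
    rw [hm]
    have h2 : ∑ k ∈ Finset.range (n + 1), ω₀ b ≤ ∑ k ∈ Finset.range (n + 1), s k b :=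
      Finset.sum_le_sum fun k _ => ω₀.mono (hmono k)
    have h3 := mul_le_mul_of_nonneg_left h2 (hpos n)
    refine le_trans (le_of_eq ?_) h3
    rw [Finset.sum_const, Finset.card_range, nsmul_eq_mul, ← mul_assoc]
    push_cast
    rw [inv_mul_cancel₀ (hne n), one_mul]

theorem exists_state_apply_eq_norm [Nontrivial A] {b : A} (hb : 0 ≤ b) :
    ∃ φ : State A, φ b = ‖b‖ := by
  obtain ⟨y, rfl⟩ := CStarAlgebra.nonneg_iff_eq_star_mul_self.mp hb
  obtain ⟨φ, hφ⟩ := exists_state_norm y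
  exact ⟨φ, by rw [hφ, CStarRing.norm_star_mul_self, sq]⟩

end InvariantState

end CQG

end

/-! ### Main theorem -/

theorem mainTheorem2 {C A : Type u} [CStarAlgebra C] [CStarAlgebra A] [PartialOrder A]
    [StarOrderedRing A] (G : CQG.CompactQuantumGroup C) (h : CQG.State C) (hh : G.IsHaarState h)
    (hfaithful : h.Faithful) (α : G.Action A) :
    (∃! E : A →ₚ[ℂ] A, α.IsInvariantCondExp E) ∧
    ∀ E : A →ₚ[ℂ] A, α.IsInvariantCondExp E →
      ∀ (P P₁ P₂ : A →CP A) (t : ℝ) (ν : CQG.State C),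
        P 1 = 1 → P₁ 1 = 1 → P₂ 1 = 1 →
        (∀ x, P (E x) = E (P x)) →
        0 < t → t < 1 →
        (∀ x, P x = (t : ℂ) • P₁ x + ((1 - t : ℝ) : ℂ) • P₂ x) →
        ν.Faithful →
        (∀ x, P₁ x = α.convOp ν x) →
        ∀ x, P x = x → x ∈ α.fixedPoints := by
  refine ⟨⟨α.convOpPositive h, α.isInvariantCondExp_convOpPositive hh, fun E hE =>
    PositiveLinearMap.ext fun x => hE.apply_eq α hh x⟩, ?_⟩
  intro E hE P P₁ P₂ t ν hP hP₁ hP₂ hPE ht0 ht1 hPt hν hPν x hx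
  -- The zero algebra has no states, so it is treated separately.
  rcases subsingleton_or_nontrivial A with hA | hA
  · have : x = E x := Subsingleton.elim _ _
    rw [this]
    exact hE.map_mem x
  set y := x - E x with hy
  have hPy : P y = y := by rw [hy, map_sub, hPE, hx]
  have hEE (a : A) : E (E a) = E a := hE.map_of_mem _ (hE.map_mem a)
  have hEy : α.convOp h y = 0 := by
    rw [← hE.apply_eq α hh, hy, map_sub, hEE, sub_self]
  have hE1 : E 1 = 1 := hE.map_of_mem 1 (by
    change α.coact 1 = _
    rw [map_one, CQG.MinTensor.tmul_one_one])
  set b := E (star y * y) with hb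
  have hb0 : 0 ≤ b := E.map_nonneg (star_mul_self_nonneg y)
  set d := P₁ y - y with hd
  -- After `E` is applied and commuted past `P`, this reads `b + t • E (star d * d) ≤ P b`.
  have hKS := OrderHomClass.mono E
    (CQG.kadison_schwarz_convex hP₁ hP₂ ht0 ht1 hPt hPy)
  rw [map_add, ← hPE, ← hd, ← hb, ← Complex.coe_smul, map_smul, Complex.coe_smul] at hKS
  have hEd : 0 ≤ E (star d * d) := E.map_nonneg (star_mul_self_nonneg d)
  have hbP : b ≤ P b := (le_add_of_nonneg_right (smul_nonneg ht0.le hEd)).trans hKS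
  obtain ⟨ω₀, hω₀⟩ := CQG.exists_state_apply_eq_norm hb0
  obtain ⟨ω, hωP, hωb⟩ := CQG.State.exists_invariant (P : A →ₗ[ℂ] A) hP
    (fun a ha => map_nonneg P ha) ω₀
  let ψ : CQG.State A := ω.comp E.toLinearMap hE1 fun a => E.map_nonneg (star_mul_self_nonneg a)
  have hψ (a : A) : ψ a = ω (E a) := rfl
  -- Since `ω (P b) = ω b`, applying `ω` to `hKS` leaves no room for the term `t * ψ (star d * d)`.
  have hψd : ψ (star d * d) = 0 := by
    have h1 := ω.mono hKS
    rw [show ω (P b) = ω b from hωP b, map_add, ← Complex.coe_smul, map_smul] at h1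
    have h2 : 0 ≤ ψ (star d * d) := ψ.nonneg d
    have h3 : (t : ℂ) * ψ (star d * d) ≤ 0 := by
      rw [hψ]
      simpa using h1
    have h4 : (t : ℂ) * ψ (star d * d) = 0 :=
      le_antisymm h3 (mul_nonneg (Complex.zero_le_real.mpr ht0.le) h2)
    exact (mul_eq_zero.mp h4).resolve_left (by exact_mod_cast ht0.ne')
  have hψy : ψ (star y * y) = 0 := by
    refine α.apply_star_mul_self_eq_zero hν (fun φ a => ?_) hEy ?_
    · rw [hψ, hψ, hE.invariant]
    · rw [← hPν]
      exact hψd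
  -- `‖b‖ = ω₀ b ≤ ω b = ψ (star y * y) = 0`.
  have hb1 : ω₀ b ≤ 0 := (hωb b hbP).trans_eq hψy
  rw [hω₀] at hb1
  have hb2 : b = 0 := norm_le_zero_iff.mp (by exact_mod_cast hb1)
  rw [hb, hE.apply_eq α hh] at hb2
  have hy0 := α.eq_zero_of_convOp_star_mul_self hfaithful hb2
  rw [hy, sub_eq_zero] at hy0
  rw [hy0]
  exact hE.map_mem x
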